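/- Fix $d\ge 2$. For $n\ge d+2$ let $K_n^{(d)}$ be the complete $(d+1)$-uniform hypergraph on the vertex set $[n]$, and let $\mathcal S_n^{(d)}$ be the (non-empty) set of sub-hypergraphs $S$ of $K_n^{(d)}$ that cover all $n$ vertices and for which the simplicial complex formed by the downward closure of $E(S)$ is homeomorphic to the sphere $\mathbb S^d$; the hyperedges of $S$ are called its facets. Give the hyperedges $e$ of $K_n^{(d)}$ independent random costs $W_e$, uniformly distributed in $[0,1]$, and let $$M(\mathcal S_n^{(d)})=\min_{S\in\mathcal S_n^{(d)}}\ \sum_{e\in E(S)}W_e ,$$ with median $\mu_n^{(d)}$. Let us say that a real number $\beta$ is a count exponent for $d$ if there is a constant $C$ such that for all $n$ and $m$ at most $2^{Cm}m^{\beta m}$ members of $\mathcal S_n^{(d)}$ have exactly $m$ facets. "With high probability" means with probability tending to $1$ as $n\to\infty$. Then: (i) There is a constant $b=b(d)$ such that $M(\mathcal S_n^{(d)})\le b\,n^{1-1/d}$ with high probability. (ii) If $\beta_d\le 1$ is a count exponent for $d$, then there is a constant $a>0$, independent of $n$, such that $M(\mathcal S_n^{(d)})\ge a\,n^{1-\beta_d}$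 with high probability. (iii) If some $\beta_d<1/2$ is a count exponent for $d$, then there is a constant $c>0$, independent of $n$ and $t$, such that for all $n\ge d+2$ and all $t>0$ $$\Pr\bigl(|M(\mathcal S_n^{(d)})-\mu_n^{(d)}|>t\bigr)\le e^{-ct^2/n}.$$ -/

import Mathlib

open MeasureTheory Filter Topology

noncomputable section

namespace SpanningSphere

/-- The hyperedges of the complete `(d+1)`-uniform hypergraph `K_n^{(d)}` on `n` vertices. -/
abbrev Edge (d n : ℕ) : Type := {e : Finset (Fin n) // e.card = d + 1}

/-- Geometric realization of the simplicial complex that is the downward closure of the set `S`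
of hyperedges: the points of the standard simplex on the `n` vertices (in barycentric coordinates)
whose support is contained in a member of `S`. It carries the subspace topology of `ℝ^n`. -/
def realization {d n : ℕ} (S : Finset (Edge d n)) : Set (Fin n → ℝ) :=
  {x | x ∈ stdSimplex ℝ (Fin n) ∧ ∃ e ∈ S, ∀ v, x v ≠ 0 → v ∈ e.1}

/-- The set of spanning `d`-spheres: sub-hypergraphs (given by their sets of
hyperedges, the facets) covering all `n` vertices, whose downward closure is homeomorphic to the
`d`-dimensional sphere. -/
def spheres (d n : ℕ) : Set (Finset (Edge d n)) :=
  {S | (∀ v : Fin n, ∃ e ∈ S, v ∈ e.1) ∧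
    Nonempty (realization S ≃ₜ Metric.sphere (0 : EuclideanSpace ℝ (Fin (d + 1))) 1)}

/-- The law of the costs: independent and uniform in `[0,1]`, one for each hyperedge. -/
def costLaw (d n : ℕ) : Measure (Edge d n → ℝ) :=
  Measure.pi fun _ => volume.restrict (Set.Icc (0 : ℝ) 1)

/-- The total cost (volume) of a sub-hypergraph. -/
def cost {d n : ℕ} (W : Edge d n → ℝ) (S : Finset (Edge d n)) : ℝ := ∑ e ∈ S, W e

/-- The minimum cost of a spanning sphere (the infimum is over a finite set, so it is
attained as soon as a spanning sphere exists). -/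
def minCost {d n : ℕ} (W : Edge d n → ℝ) : ℝ := sInf (cost W '' spheres d n)

/-- `μ` is a median of the random variable `X`. -/
def IsMedian {Ω : Type*} [MeasurableSpace Ω] (P : Measure Ω) (X : Ω → ℝ) (μ : ℝ) : Prop :=
  1 / 2 ≤ P.real {ω | X ω ≤ μ} ∧ 1 / 2 ≤ P.real {ω | μ ≤ X ω}

/-- `β` is an admissible count exponent in dimension `d`: at most `2^{O(m)} m^{β m}` spanning
`d`-spheres on `n` labelled vertices have `m` facets, with an implied constant that is uniform
in `n` and `m`. -/
def IsCountExponent (d : ℕ) (β : ℝ) : Prop :=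
  ∃ C : ℝ, ∀ n m : ℕ,
    (({S | S ∈ spheres d n ∧ S.card = m} : Set (Finset (Edge d n))).ncard : ℝ)
      ≤ (2 : ℝ) ^ (C * m) * (m : ℝ) ^ (β * m)

end SpanningSphere

end

/-!
Upper bound: subdividing a facet of a sphere at a new vertex gives a sphere again. Starting from the
boundary of a simplex, always subdivide the facet created by the previous step, choosing among the
`k` remaining vertices the one whose `d` other new facets are cheapest. Their cost is of order
`k^(-1/d)`, and the facets inspected at different steps are disjoint, so the expected total cost
is `O(∑ k^(-1/d)) = O(n^(1-1/d))`.

Concentration: `√M` is `1`-Lipschitz for the Euclidean norm in the variables `√W_e`, because the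
optimal sphere for one cost vector is a competitor for every other one. Each `√W_e` has a
log-concave density, so the Prékopa–Leindler inequality, applied in one variable and tensorised,
gives a dimension-free Gaussian isoperimetric inequality for `√M`. It improves the bound on the
expectation to one with high probability, and together with `M ≤ d n` it yields a Gaussian tail of
variance `O(n)` for `M`.

Lower bound: the sum of `m` independent uniform variables is at most `x` with probability at most
`(e x / m)^m`, so a union bound over the spheres with `m` facets, followed by a sum over `m`,
applies as soon as the number of these spheres is controlled by a count exponent.
-/

noncomputable section

namespace SpanningSphere

section Realization

variable {d n : ℕ} {S : Finset (Edge d n)} {F : Edge d n} {u v w : Fin n}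

theorem mem_realization_iff {x : Fin n → ℝ} :
    x ∈ realization S ↔ x ∈ stdSimplex ℝ (Fin n) ∧ ∃ e ∈ S, ∀ v ∉ e.1, x v = 0 := by
  simp only [realization, Set.mem_ofPred_eq, ne_eq, not_imp_comm]

theorem edge_nonempty (F : Edge d n) : F.1.Nonempty :=
  Finset.card_pos.1 (F.2.symm ▸ d.succ_pos)

theorem exists_mem_notMem_of_ne {e : Edge d n} (h : e ≠ F) : ∃ u ∈ F.1, u ∉ e.1 := by
  by_contra! hFe
  exact h (Subtype.ext (Finset.eq_of_subset_of_card_le hFe (by rw [F.2, e.2])).symm)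

theorem apply_eq_zero_of_mem_realization (hS : ∀ e ∈ S, v ∉ e.1) {x : Fin n → ℝ}
    (hx : x ∈ realization S) : x v = 0 := by
  obtain ⟨-, e, he, hxe⟩ := mem_realization_iff.1 hx
  exact hxe v (hS e he)

/-- All hyperedges inside a vertex set `A`; for `A` of size `d + 2` these are the facets of the
boundary of a `(d + 1)`-simplex. -/
def facetsIn (d : ℕ) {n : ℕ} (A : Finset (Fin n)) : Finset (Edge d n) := {e | e.1 ⊆ A}

theorem mem_facetsIn {A : Finset (Fin n)} {e : Edge d n} : e ∈ facetsIn d A ↔ e.1 ⊆ A := by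
  simp [facetsIn]

theorem mem_realization_facetsIn {A : Finset (Fin n)} (hA : A.card = d + 2) {x : Fin n → ℝ} :
    x ∈ realization (facetsIn d A) ↔
      x ∈ stdSimplex ℝ (Fin n) ∧ (∀ v ∉ A, x v = 0) ∧ ∃ v ∈ A, x v = 0 := by
  rw [mem_realization_iff]
  refine and_congr_right fun _ => ⟨?_, ?_⟩
  · rintro ⟨e, heA, hxe⟩
    obtain ⟨v, hvA, hve⟩ := Finset.exists_mem_notMem_of_card_lt_card (by lia : e.1.card < A.card)
    exact ⟨fun w hw => hxe w fun hwe => hw (mem_facetsIn.1 heA hwe), v, hvA, hxe v hve⟩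
  · rintro ⟨hxA, v, hvA, hxv⟩
    refine ⟨⟨A.erase v, by rw [Finset.card_erase_of_mem hvA, hA]; rfl⟩,
      mem_facetsIn.2 (Finset.erase_subset _ _), fun w hw => ?_⟩
    by_cases hwA : w ∈ A
    · obtain rfl : w = v := by simpa [hwA] using hw
      exact hxv
    · exact hxA w hwA

end Realization

section SimplexBoundary

variable {ι E : Type*} [NormedAddCommGroup E] [NormedSpace ℝ E]

theorem mem_frontier_convexHull_range_iff [Finite ι] (b : AffineBasis ι ℝ E) {x : E} :
    x ∈ frontier (convexHull ℝ (Set.range b)) ↔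
      (∀ i, 0 ≤ b.coord i x) ∧ ∃ i, b.coord i x = 0 := by
  rw [((Set.finite_range b).isClosed_convexHull ℝ).frontier_eq, b.interior_convexHull,
    b.convexHull_eq_nonneg_coord]
  simp only [Set.mem_sdiff, Set.mem_ofPred_eq, not_forall, not_lt]
  exact and_congr_right fun hx => exists_congr fun i => (hx i).ge_iff_eq'

theorem nonempty_frontier_convexHull_homeomorph_sphere [Finite ι] (b : AffineBasis ι ℝ E) :
    Nonempty (frontier (convexHull ℝ (Set.range b)) ≃ₜ Metric.sphere (0 : E) 1) := by
  have := Fintype.ofFinite ι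
  obtain ⟨h, -, -, hfrontier⟩ := exists_homeomorph_image_interior_closure_frontier_eq_unitBall
    (convex_convexHull ℝ (Set.range b)) ⟨_, b.centroid_mem_interior_convexHull⟩
    (isBounded_convexHull.2 (Set.finite_range b).isBounded)
  exact ⟨(h.image _).trans (.setCongr hfrontier)⟩

theorem coord_sum_smul [Fintype ι] (b : AffineBasis ι ℝ E) {w : ι → ℝ} (hw : ∑ i, w i = 1)
    (i : ι) : b.coord i (∑ j, w j • b j) = w i := by
  rw [← Finset.affineCombination_eq_linear_combination _ _ _ hw,
    b.coord_apply_combination_of_mem (Finset.mem_univ i) hw]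

variable {d n : ℕ} {A : Finset (Fin n)}

theorem sum_subtype_eq_sum {x : Fin n → ℝ} (hx : ∀ v ∉ A, x v = 0) : ∑ a : A, x a = ∑ v, x v := by
  rw [Finset.sum_coe_sort A x]
  exact Finset.sum_subset A.subset_univ fun v _ hv => hx v hv

theorem coord_sum_smul_of_mem_realization (hA : A.card = d + 2) (b : AffineBasis A ℝ E)
    {x : Fin n → ℝ} (hx : x ∈ realization (facetsIn d A)) (a : A) :
    b.coord a (∑ c : A, x c • b c) = x a := by
  obtain ⟨⟨-, hsum⟩, hxA, -⟩ := (mem_realization_facetsIn hA).1 hx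
  exact coord_sum_smul b ((sum_subtype_eq_sum hxA).trans hsum) a

theorem sum_smul_mem_frontier (hA : A.card = d + 2) (b : AffineBasis A ℝ E) {x : Fin n → ℝ}
    (hx : x ∈ realization (facetsIn d A)) :
    ∑ a : A, x a • b a ∈ frontier (convexHull ℝ (Set.range b)) := by
  obtain ⟨⟨hnonneg, -⟩, -, v, hv, hxv⟩ := (mem_realization_facetsIn hA).1 hx
  simp only [mem_frontier_convexHull_range_iff, coord_sum_smul_of_mem_realization hA b hx]
  exact ⟨fun a => hnonneg a, ⟨v, hv⟩, hxv⟩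

/-- The barycentric coordinates of a point of `E` with respect to an affine basis indexed by the
vertex set `A`, extended by `0` to all vertices. -/
def extendCoord (b : AffineBasis A ℝ E) (y : E) (v : Fin n) : ℝ :=
  if hv : v ∈ A then b.coord ⟨v, hv⟩ y else 0

theorem extendCoord_coe (b : AffineBasis A ℝ E) (y : E) (a : A) :
    extendCoord b y a = b.coord a y := by
  simp [extendCoord]

theorem extendCoord_of_notMem (b : AffineBasis A ℝ E) (y : E) {v : Fin n} (hv : v ∉ A) :
    extendCoord b y v = 0 := dif_neg hv

theorem continuous_extendCoord [FiniteDimensional ℝ E] (b : AffineBasis A ℝ E) :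
    Continuous (extendCoord b) := by
  refine continuous_pi fun v => ?_
  by_cases hv : v ∈ A
  · simpa only [extendCoord, dif_pos hv] using continuous_barycentric_coord b ⟨v, hv⟩
  · simpa only [extendCoord, dif_neg hv] using continuous_const

theorem extendCoord_mem_realization (hA : A.card = d + 2) (b : AffineBasis A ℝ E) {y : E}
    (hy : y ∈ frontier (convexHull ℝ (Set.range b))) :
    extendCoord b y ∈ realization (facetsIn d A) := by
  obtain ⟨hnonneg, a, ha⟩ := (mem_frontier_convexHull_range_iff b).1 hy
  refine (mem_realization_facetsIn hA).2 ⟨⟨fun v => ?_, ?_⟩,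
    fun v => extendCoord_of_notMem b y, a, a.2, (extendCoord_coe b y a).trans ha⟩
  · by_cases hv : v ∈ A
    · exact (hnonneg ⟨v, hv⟩).trans_eq (extendCoord_coe b y ⟨v, hv⟩).symm
    · exact (extendCoord_of_notMem b y hv).ge
  · rw [← sum_subtype_eq_sum fun v => extendCoord_of_notMem b y]
    simp only [extendCoord_coe, b.sum_coord_apply_eq_one]

/-- The boundary of the abstract simplex on the vertex set `A`, placed in `E` by sending the
vertices to an affine basis. -/
def realizationFacetsInHomeomorph [FiniteDimensional ℝ E] (hA : A.card = d + 2)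
    (b : AffineBasis A ℝ E) :
    realization (facetsIn d A) ≃ₜ frontier (convexHull ℝ (Set.range b)) where
  toFun x := ⟨∑ a : A, x.1 a • b a, sum_smul_mem_frontier hA b x.2⟩
  invFun y := ⟨extendCoord b y, extendCoord_mem_realization hA b y.2⟩
  left_inv x := by
    ext v
    by_cases hv : v ∈ A
    · exact (extendCoord_coe b _ ⟨v, hv⟩).trans (coord_sum_smul_of_mem_realization hA b x.2 _)
    · exact (extendCoord_of_notMem b _ hv).trans
        (((mem_realization_facetsIn hA).1 x.2).2.1 v hv).symm
  right_inv y := Subtype.ext <| by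
    simp only [extendCoord_coe, b.linear_combination_coord_eq_self]
  continuous_toFun := (continuous_finsetSum _ fun a _ =>
    ((continuous_apply _).comp continuous_subtype_val).smul continuous_const).subtype_mk _
  continuous_invFun := ((continuous_extendCoord b).comp continuous_subtype_val).subtype_mk _

theorem nonempty_realization_facetsIn_homeomorph_sphere (hA : A.card = d + 2) :
    Nonempty (realization (facetsIn d A) ≃ₜ
      Metric.sphere (0 : EuclideanSpace ℝ (Fin (d + 1))) 1) := by
  obtain ⟨b⟩ : Nonempty (AffineBasis A ℝ (EuclideanSpace ℝ (Fin (d + 1)))) :=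
    AffineBasis.exists_affineBasis_of_finiteDimensional (by simp [hA])
  obtain ⟨h⟩ := nonempty_frontier_convexHull_homeomorph_sphere b
  exact ⟨(realizationFacetsInHomeomorph hA b).trans h⟩

end SimplexBoundary

section StellarSubdivision

variable {d n : ℕ} {S : Finset (Edge d n)} {F : Edge d n} {u v w : Fin n}

/-- The hyperedge obtained from `F` by replacing the vertex `u` by `v`, with junk value `F` unless
this is again a set of `d + 1` vertices. -/
def swap (F : Edge d n) (u v : Fin n) : Edge d n :=
  if h : (insert v (F.1.erase u)).card = d + 1 then ⟨insert v (F.1.erase u), h⟩ else F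

theorem swap_val (hu : u ∈ F.1) (hv : v ∉ F.1) :
    (swap F u v).1 = insert v (F.1.erase u) := by
  have hcard : (insert v (F.1.erase u)).card = d + 1 := by
    rw [Finset.card_insert_of_notMem (by simp [hv]), Finset.card_erase_add_one hu, F.2]
  rw [swap, dif_pos hcard]

theorem mem_swap (hu : u ∈ F.1) (hv : v ∉ F.1) :
    w ∈ (swap F u v).1 ↔ w = v ∨ w ≠ u ∧ w ∈ F.1 := by
  rw [swap_val hu hv, Finset.mem_insert, Finset.mem_erase]

theorem notMem_swap (hu : u ∈ F.1) (hv : v ∉ F.1) : u ∉ (swap F u v).1 := by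
  grind [mem_swap hu hv]

theorem swap_injOn (hv : v ∉ F.1) :
    Set.InjOn (fun u => swap F u v) (F.1 : Set (Fin n)) := by
  intro u hu u' hu' (h : swap F u v = swap F u' v)
  have huu' : u ∉ (swap F u' v).1 := h ▸ notMem_swap hu hv
  by_contra hne
  exact huu' ((mem_swap hu' hv).2 (.inr ⟨hne, hu⟩))

/-- Stellar subdivision of the facet `F` of `S` at a new vertex `v`. -/
def subdivide (S : Finset (Edge d n)) (F : Edge d n) (v : Fin n) : Finset (Edge d n) :=
  S.erase F ∪ F.1.image fun u => swap F u v

theorem mem_subdivide {e : Edge d n} :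
    e ∈ subdivide S F v ↔ (e ≠ F ∧ e ∈ S) ∨ ∃ u ∈ F.1, swap F u v = e := by
  simp only [subdivide, Finset.mem_union, Finset.mem_erase, Finset.mem_image]

/-- The smallest barycentric coordinate on the face `F`. -/
def minCoord (F : Edge d n) (x : Fin n → ℝ) : ℝ := F.1.inf' (edge_nonempty F) x

theorem minCoord_le (hu : u ∈ F.1) (x : Fin n → ℝ) : minCoord F x ≤ x u := Finset.inf'_le _ hu

theorem exists_minCoord_eq (F : Edge d n) (x : Fin n → ℝ) :
    ∃ u ∈ F.1, minCoord F x = x u := Finset.exists_mem_eq_inf' _ _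

theorem continuous_minCoord (F : Edge d n) : Continuous (minCoord F) :=
  Continuous.finset_inf'_apply _ fun i _ => continuous_apply i

theorem minCoord_nonneg {x : Fin n → ℝ} (hx : ∀ w, 0 ≤ x w) : 0 ≤ minCoord F x :=
  Finset.le_inf' _ _ fun w _ => hx w

theorem minCoord_eq_zero {x : Fin n → ℝ} (hx : ∀ w, 0 ≤ x w) (hu : u ∈ F.1) (hxu : x u = 0) :
    minCoord F x = 0 :=
  le_antisymm (hxu ▸ minCoord_le hu x) (minCoord_nonneg hx)

/-- The direction from the barycentre of `F` to the vertex `v`, scaled by `d + 1`. Moving a point of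
`F` along it until the boundary of `F` is hit gives its position in the cone over that boundary with
apex `v`. -/
def coneDirection (F : Edge d n) (v : Fin n) : Fin n → ℝ :=
  Pi.single v (d + 1 : ℝ) - (F.1 : Set (Fin n)).indicator 1

theorem coneDirection_apply_self (hv : v ∉ F.1) : coneDirection F v v = d + 1 := by
  simp [coneDirection, hv]

theorem coneDirection_apply_of_mem (hv : v ∉ F.1) (hw : w ∈ F.1) : coneDirection F v w = -1 := by
  simp [coneDirection, hw, ne_of_mem_of_not_mem hw hv]

theorem coneDirection_apply_of_notMem (hw : w ∉ F.1) (hwv : w ≠ v) : coneDirection F v w = 0 := by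
  simp [coneDirection, hw, hwv]

theorem sum_coneDirection (F : Edge d n) (v : Fin n) : ∑ w, coneDirection F v w = 0 := by
  simp [coneDirection, Finset.sum_sub_distrib, Set.indicator_apply, F.2]

/-- The piecewise linear map from `F` onto the cone over its boundary with apex `v`. -/
def toSubdivision (F : Edge d n) (v : Fin n) (x : Fin n → ℝ) : Fin n → ℝ :=
  x + minCoord F x • coneDirection F v

/-- The linear map sending the vertex `v` to the barycentre of `F`. -/
def ofSubdivision (F : Edge d n) (v : Fin n) (x : Fin n → ℝ) : Fin n → ℝ :=
  x - (x v / (d + 1)) • coneDirection F v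

theorem continuous_toSubdivision (F : Edge d n) (v : Fin n) : Continuous (toSubdivision F v) :=
  continuous_id.add ((continuous_minCoord F).smul continuous_const)

theorem continuous_ofSubdivision (F : Edge d n) (v : Fin n) : Continuous (ofSubdivision F v) := by
  unfold ofSubdivision
  fun_prop

theorem sum_toSubdivision (F : Edge d n) (v : Fin n) (x : Fin n → ℝ) :
    ∑ w, toSubdivision F v x w = ∑ w, x w := by
  simp [toSubdivision, Finset.sum_add_distrib, ← Finset.mul_sum, sum_coneDirection]

theorem sum_ofSubdivision (F : Edge d n) (v : Fin n) (x : Fin n → ℝ) :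
    ∑ w, ofSubdivision F v x w = ∑ w, x w := by
  simp [ofSubdivision, Finset.sum_sub_distrib, ← Finset.mul_sum, sum_coneDirection]

theorem toSubdivision_apply_of_mem (hv : v ∉ F.1) (hw : w ∈ F.1) (x : Fin n → ℝ) :
    toSubdivision F v x w = x w - minCoord F x := by
  simp [toSubdivision, coneDirection_apply_of_mem hv hw, sub_eq_add_neg]

theorem toSubdivision_apply_self (hv : v ∉ F.1) (x : Fin n → ℝ) :
    toSubdivision F v x v = x v + minCoord F x * (d + 1) := by
  simp [toSubdivision, coneDirection_apply_self hv]

theorem toSubdivision_apply_of_notMem (hw : w ∉ F.1) (hwv : w ≠ v) (x : Fin n → ℝ) :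
    toSubdivision F v x w = x w := by
  simp [toSubdivision, coneDirection_apply_of_notMem hw hwv]

theorem ofSubdivision_apply_of_mem (hv : v ∉ F.1) (hw : w ∈ F.1) (x : Fin n → ℝ) :
    ofSubdivision F v x w = x w + x v / (d + 1) := by
  simp [ofSubdivision, coneDirection_apply_of_mem hv hw]

theorem ofSubdivision_apply_self (hv : v ∉ F.1) (x : Fin n → ℝ) : ofSubdivision F v x v = 0 := by
  have : (d : ℝ) + 1 ≠ 0 := by positivity
  simp [ofSubdivision, coneDirection_apply_self hv, this]

theorem ofSubdivision_apply_of_notMem (hw : w ∉ F.1) (hwv : w ≠ v) (x : Fin n → ℝ) :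
    ofSubdivision F v x w = x w := by
  simp [ofSubdivision, coneDirection_apply_of_notMem hw hwv]

theorem toSubdivision_mem_stdSimplex (hv : v ∉ F.1) {x : Fin n → ℝ}
    (hx : x ∈ stdSimplex ℝ (Fin n)) : toSubdivision F v x ∈ stdSimplex ℝ (Fin n) := by
  refine ⟨fun w => ?_, (sum_toSubdivision F v x).trans hx.2⟩
  have hmin := minCoord_nonneg (F := F) hx.1
  by_cases hw : w ∈ F.1
  · rw [toSubdivision_apply_of_mem hv hw]
    exact sub_nonneg.2 (minCoord_le hw x)
  · rcases eq_or_ne w v with rfl | hwv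
    · rw [toSubdivision_apply_self hv]
      exact add_nonneg (hx.1 w) (by positivity)
    · rw [toSubdivision_apply_of_notMem hw hwv]
      exact hx.1 w

theorem ofSubdivision_mem_stdSimplex (hv : v ∉ F.1) {x : Fin n → ℝ}
    (hx : x ∈ stdSimplex ℝ (Fin n)) : ofSubdivision F v x ∈ stdSimplex ℝ (Fin n) := by
  refine ⟨fun w => ?_, (sum_ofSubdivision F v x).trans hx.2⟩
  by_cases hw : w ∈ F.1
  · rw [ofSubdivision_apply_of_mem hv hw]
    exact add_nonneg (hx.1 w) (div_nonneg (hx.1 v) (by positivity))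
  · rcases eq_or_ne w v with rfl | hwv
    · exact (ofSubdivision_apply_self hv x).ge
    · rw [ofSubdivision_apply_of_notMem hw hwv]
      exact hx.1 w

theorem toSubdivision_mem_realization (hF : F ∈ S) (hS : ∀ e ∈ S, v ∉ e.1) {x : Fin n → ℝ}
    (hx : x ∈ realization S) : toSubdivision F v x ∈ realization (subdivide S F v) := by
  obtain ⟨hsimplex, e, he, hxe⟩ := mem_realization_iff.1 hx
  have hv := hS F hF
  refine mem_realization_iff.2 ⟨toSubdivision_mem_stdSimplex hv hsimplex, ?_⟩
  rcases eq_or_ne e F with rfl | hne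
  · obtain ⟨u, hu, hmin⟩ := exists_minCoord_eq e x
    refine ⟨swap e u v, mem_subdivide.2 (.inr ⟨u, hu, rfl⟩), fun w hw => ?_⟩
    obtain ⟨hwv, hwu⟩ : w ≠ v ∧ (w ∈ e.1 → w = u) := by grind [mem_swap hu hv]
    by_cases hwe : w ∈ e.1
    · rw [toSubdivision_apply_of_mem hv hwe, hwu hwe, hmin, sub_self]
    · rw [toSubdivision_apply_of_notMem hwe hwv, hxe w hwe]
  · obtain ⟨u, hu, hue⟩ := exists_mem_notMem_of_ne hne
    have hmin := minCoord_eq_zero hsimplex.1 hu (hxe u hue)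
    refine ⟨e, mem_subdivide.2 (.inl ⟨hne, he⟩), fun w hw => ?_⟩
    simp [toSubdivision, hmin, hxe w hw]

theorem ofSubdivision_mem_realization (hF : F ∈ S) (hS : ∀ e ∈ S, v ∉ e.1) {x : Fin n → ℝ}
    (hx : x ∈ realization (subdivide S F v)) : ofSubdivision F v x ∈ realization S := by
  obtain ⟨hsimplex, e, he, hxe⟩ := mem_realization_iff.1 hx
  have hv := hS F hF
  refine mem_realization_iff.2 ⟨ofSubdivision_mem_stdSimplex hv hsimplex, ?_⟩
  rcases mem_subdivide.1 he with ⟨-, heS⟩ | ⟨u, hu, rfl⟩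
  · refine ⟨e, heS, fun w hw => ?_⟩
    simp [ofSubdivision, hxe v (hS e heS), hxe w hw]
  · refine ⟨F, hF, fun w hw => ?_⟩
    rcases eq_or_ne w v with rfl | hwv
    · exact ofSubdivision_apply_self hv x
    · rw [ofSubdivision_apply_of_notMem hw hwv]
      exact hxe w (by simp [mem_swap hu hv, hw, hwv])

theorem minCoord_eq_zero_of_mem_realization_subdivide (hv : v ∉ F.1) {x : Fin n → ℝ}
    (hx : x ∈ realization (subdivide S F v)) : minCoord F x = 0 := by
  obtain ⟨hsimplex, e, he, hxe⟩ := mem_realization_iff.1 hx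
  obtain ⟨u, hu, hue⟩ : ∃ u ∈ F.1, u ∉ e.1 := by
    rcases mem_subdivide.1 he with ⟨hne, -⟩ | ⟨u, hu, rfl⟩
    exacts [exists_mem_notMem_of_ne hne, ⟨u, hu, notMem_swap hu hv⟩]
  exact minCoord_eq_zero hsimplex.1 hu (hxe u hue)

theorem ofSubdivision_toSubdivision (hv : v ∉ F.1) {x : Fin n → ℝ} (hxv : x v = 0) :
    ofSubdivision F v (toSubdivision F v x) = x := by
  have : (d : ℝ) + 1 ≠ 0 := by positivity
  rw [ofSubdivision, toSubdivision_apply_self hv, hxv, zero_add, mul_div_cancel_right₀ _ this,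
    toSubdivision, add_sub_cancel_right]

theorem minCoord_ofSubdivision (hv : v ∉ F.1) (x : Fin n → ℝ) :
    minCoord F (ofSubdivision F v x) = minCoord F x + x v / (d + 1) := by
  refine le_antisymm ?_ (Finset.le_inf' _ _ fun w hw => ?_)
  · obtain ⟨u, hu, hmin⟩ := exists_minCoord_eq F x
    rw [hmin, ← ofSubdivision_apply_of_mem hv hu]
    exact minCoord_le hu _
  · rw [ofSubdivision_apply_of_mem hv hw]
    gcongr
    exact minCoord_le hw x

theorem toSubdivision_ofSubdivision (hv : v ∉ F.1) {x : Fin n → ℝ} (hx : minCoord F x = 0) :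
    toSubdivision F v (ofSubdivision F v x) = x := by
  rw [toSubdivision, minCoord_ofSubdivision hv, hx, zero_add, ofSubdivision, sub_add_cancel]

/-- Stellar subdivision does not change the homeomorphism type. -/
def realizationSubdivideHomeomorph (hF : F ∈ S) (hS : ∀ e ∈ S, v ∉ e.1) :
    realization S ≃ₜ realization (subdivide S F v) where
  toFun x := ⟨toSubdivision F v x, toSubdivision_mem_realization hF hS x.2⟩
  invFun x := ⟨ofSubdivision F v x, ofSubdivision_mem_realization hF hS x.2⟩
  left_inv x := Subtype.ext <|
    ofSubdivision_toSubdivision (hS F hF) (apply_eq_zero_of_mem_realization hS x.2)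
  right_inv x := Subtype.ext <| toSubdivision_ofSubdivision (hS F hF) <|
    minCoord_eq_zero_of_mem_realization_subdivide (hS F hF) x.2
  continuous_toFun := ((continuous_toSubdivision F v).comp continuous_subtype_val).subtype_mk _
  continuous_invFun := ((continuous_ofSubdivision F v).comp continuous_subtype_val).subtype_mk _

end StellarSubdivision

section PartialSphere

variable {d n : ℕ} {S : Finset (Edge d n)} {F : Edge d n} {U R : Finset (Fin n)} {v w : Fin n}
  {W : Edge d n → ℝ}

/-- `S` is a `d`-sphere with vertex set `U` and with a distinguished facet `F`, the open facet, at
which the next vertex is going to be inserted. -/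
structure IsPartialSphere (S : Finset (Edge d n)) (F : Edge d n) (U : Finset (Fin n)) : Prop where
  homeomorph : Nonempty (realization S ≃ₜ Metric.sphere (0 : EuclideanSpace ℝ (Fin (d + 1))) 1)
  mem : F ∈ S
  cover : ∀ v, v ∈ U ↔ ∃ e ∈ S, v ∈ e.1

theorem IsPartialSphere.subset (h : IsPartialSphere S F U) : F.1 ⊆ U :=
  fun v hv => (h.cover v).2 ⟨F, h.mem, hv⟩

theorem IsPartialSphere.notMem (h : IsPartialSphere S F U) (hv : v ∉ U) : ∀ e ∈ S, v ∉ e.1 :=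
  fun e he hve => hv ((h.cover v).2 ⟨e, he, hve⟩)

theorem IsPartialSphere.mem_spheres (h : IsPartialSphere S F U) (hU : U = Finset.univ) :
    S ∈ spheres d n :=
  ⟨fun v => (h.cover v).1 (hU ▸ Finset.mem_univ v), h.homeomorph⟩

/-- The vertex of `F` that is dropped when `F` is replaced by the next open facet; any choice
depending on `F` alone would do. -/
def pivot (F : Edge d n) : Fin n := F.1.min' (edge_nonempty F)

theorem pivot_mem (F : Edge d n) : pivot F ∈ F.1 := Finset.min'_mem _ _

/-- The facet that stays open when `F` is subdivided at `v`. -/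
def nextFacet (F : Edge d n) (v : Fin n) : Edge d n := swap F (pivot F) v

/-- The price of the facets that become final when `F` is subdivided at `v`. -/
def stepCost (W : Edge d n → ℝ) (F : Edge d n) (v : Fin n) : ℝ :=
  ∑ u ∈ F.1.erase (pivot F), W (swap F u v)

theorem exists_mem_subdivide_iff (hd : 1 ≤ d) (hF : F ∈ S) (hv : v ∉ F.1) :
    (∃ e ∈ subdivide S F v, w ∈ e.1) ↔ w = v ∨ ∃ e ∈ S, w ∈ e.1 := by
  constructor
  · rintro ⟨e, he, hwe⟩
    rcases mem_subdivide.1 he with ⟨-, heS⟩ | ⟨u, hu, rfl⟩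
    · exact .inr ⟨e, heS, hwe⟩
    · exact ((mem_swap hu hv).1 hwe).imp_right fun h => ⟨F, hF, h.2⟩
  · have mem_of_ne : ∀ u ∈ F.1, (w = v ∨ w ≠ u ∧ w ∈ F.1) → ∃ e ∈ subdivide S F v, w ∈ e.1 :=
      fun u hu hw => ⟨_, mem_subdivide.2 (.inr ⟨u, hu, rfl⟩), (mem_swap hu hv).2 hw⟩
    rintro (rfl | ⟨e, he, hwe⟩)
    · exact mem_of_ne _ (pivot_mem F) (.inl rfl)
    · rcases eq_or_ne e F with rfl | hne
      · obtain ⟨u, hu, huw⟩ := Finset.exists_mem_ne (by lia : 1 < e.1.card) w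
        exact mem_of_ne u hu (.inr ⟨huw.symm, hwe⟩)
      · exact ⟨e, mem_subdivide.2 (.inl ⟨hne, he⟩), hwe⟩

theorem IsPartialSphere.subdivide (hd : 1 ≤ d) (h : IsPartialSphere S F U) (hv : v ∉ U) :
    IsPartialSphere (subdivide S F v) (nextFacet F v) (insert v U) where
  homeomorph := h.homeomorph.map (realizationSubdivideHomeomorph h.mem (h.notMem hv)).symm.trans
  mem := mem_subdivide.2 (.inr ⟨_, pivot_mem F, rfl⟩)
  cover w := by
    rw [exists_mem_subdivide_iff hd h.mem (h.notMem hv F h.mem), Finset.mem_insert, h.cover]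

theorem cost_subdivide (hF : F ∈ S) (hS : ∀ e ∈ S, v ∉ e.1) (W : Edge d n → ℝ) :
    cost W (subdivide S F v) - W (nextFacet F v) = cost W S - W F + stepCost W F v := by
  have hv := hS F hF
  have hdisj : Disjoint (S.erase F) (F.1.image fun u => swap F u v) := by
    refine Finset.disjoint_left.2 fun e he he' => ?_
    obtain ⟨u, hu, rfl⟩ := Finset.mem_image.1 he'
    exact hS _ (Finset.mem_of_mem_erase he) ((mem_swap hu hv).2 (.inl rfl))
  rw [cost, subdivide, Finset.sum_union hdisj, Finset.sum_image (swap_injOn hv), cost,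
    ← Finset.add_sum_erase S _ hF, stepCost, ← Finset.add_sum_erase F.1 _ (pivot_mem F),
    nextFacet]
  ring

theorem stepCost_le {b : ℝ} (hW : ∀ u ∈ F.1.erase (pivot F), W (swap F u v) ≤ b) :
    stepCost W F v ≤ d * b := by
  refine (Finset.sum_le_card_nsmul _ _ b hW).trans_eq ?_
  simp [Finset.card_erase_of_mem (pivot_mem F), F.2]

/-- The cheapest way to insert `r` vertices of `R` one by one, always subdividing the open facet,
when the last open facet is not paid for. -/
def insertionCost : ℕ → Edge d n → Finset (Fin n) → (Edge d n → ℝ) → ENNReal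
  | 0, _, _, _ => 0
  | r + 1, F, R, W => ⨅ v ∈ R, (ENNReal.ofReal (stepCost W F v) +
      insertionCost r (nextFacet F v) (R.erase v) W)

theorem IsPartialSphere.exists_sphere_cost_le (hd : 1 ≤ d) (W : Edge d n → ℝ)
    (h : IsPartialSphere S F U) {r : ℕ} (hU : Uᶜ.card = r) :
    ∃ S' ∈ spheres d n, ∃ F' ∈ S', ENNReal.ofReal (cost W S' - W F') ≤
      ENNReal.ofReal (cost W S - W F) + insertionCost r F Uᶜ W := by
  induction r generalizing S F U with
  | zero => exact ⟨S, h.mem_spheres (by simpa using hU), F, h.mem, le_self_add⟩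
  | succ r ih =>
    obtain ⟨v, hv, hmin⟩ := Finset.exists_mem_eq_inf Uᶜ (Finset.card_pos.1 (by lia)) fun v =>
      ENNReal.ofReal (stepCost W F v) + insertionCost r (nextFacet F v) (Uᶜ.erase v) W
    have hvU : v ∉ U := Finset.mem_compl.1 hv
    have hcompl : (insert v U)ᶜ = Uᶜ.erase v := Finset.compl_insert
    obtain ⟨S', hS', F', hF', hle⟩ := ih (h.subdivide hd hvU)
      (by rw [hcompl, Finset.card_erase_of_mem hv, hU]; rfl)
    refine ⟨S', hS', F', hF', hle.trans ?_⟩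
    rw [cost_subdivide h.mem (h.notMem hvU), hcompl, insertionCost, ← Finset.inf_eq_iInf, hmin,
      ← add_assoc]
    gcongr
    exact ENNReal.ofReal_add_le

theorem insertionCost_le (hW : ∀ e, W e ≤ 1) {r : ℕ} (hR : R.card = r) :
    insertionCost r F R W ≤ d * r := by
  induction r generalizing F R with
  | zero => simp [insertionCost]
  | succ r ih =>
    obtain ⟨v, hv⟩ : R.Nonempty := Finset.card_pos.1 (by lia)
    calc insertionCost (r + 1) F R W
        ≤ ENNReal.ofReal (stepCost W F v) + insertionCost r (nextFacet F v) (R.erase v) W :=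
          iInf₂_le v hv
      _ ≤ d + d * r := by
          gcongr
          · exact ENNReal.ofReal_le_natCast.2 ((stepCost_le fun u _ => hW _).trans_eq (mul_one _))
          · exact ih (by rw [Finset.card_erase_of_mem hv, hR]; rfl)
      _ = d * (r + 1 : ℕ) := by push_cast; ring

theorem nextFacet_union_subset (hv : v ∈ R) (hR : Disjoint F.1 R) :
    (nextFacet F v).1 ∪ R.erase v ⊆ (F.1 ∪ R).erase (pivot F) := by
  have hvF : v ∉ F.1 := Finset.disjoint_right.1 hR hv
  have hp : pivot F ∉ R := Finset.disjoint_left.1 hR (pivot_mem F)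
  intro w hw
  simp only [nextFacet, Finset.mem_union, mem_swap (pivot_mem F) hvF, Finset.mem_erase] at hw ⊢
  grind

theorem disjoint_nextFacet (hv : v ∈ R) (hR : Disjoint F.1 R) :
    Disjoint (nextFacet F v).1 (R.erase v) := by
  have hvF : v ∉ F.1 := Finset.disjoint_right.1 hR hv
  refine Finset.disjoint_left.2 fun w hw hwR => ?_
  rw [nextFacet, mem_swap (pivot_mem F) hvF] at hw
  have := Finset.disjoint_right.1 hR (Finset.mem_of_mem_erase hwR)
  grind

theorem measurable_stepCost (F : Edge d n) (v : Fin n) :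
    Measurable fun W : Edge d n → ℝ => stepCost W F v :=
  Finset.measurable_sum _ fun _ _ => measurable_pi_apply _

theorem measurable_insertionCost (r : ℕ) (F : Edge d n) (R : Finset (Fin n)) :
    Measurable (insertionCost r F R) := by
  induction r generalizing F R with
  | zero => exact measurable_const
  | succ r ih =>
    exact Measurable.iInf fun v => Measurable.iInf fun _ =>
      (measurable_stepCost F v).ennreal_ofReal.add (ih _ _)

end PartialSphere

section MinCost

variable {d n : ℕ} {A : Finset (Fin n)} {W : Edge d n → ℝ}

theorem card_facetsIn (d : ℕ) (A : Finset (Fin n)) :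
    (facetsIn d A).card = A.card.choose (d + 1) := by
  rw [← Finset.card_powersetCard, ← Finset.card_map (Function.Embedding.subtype _)]
  congr 1
  ext s
  simp [mem_facetsIn, Finset.mem_powersetCard]

theorem exists_mem_facetsIn (hA : d + 1 < A.card) {v : Fin n} (hv : v ∈ A) :
    ∃ e ∈ facetsIn d A, v ∈ e.1 := by
  obtain ⟨e, hve, heA, hcard⟩ := Finset.exists_subsuperset_card_eq
    (Finset.singleton_subset_iff.2 hv) (by simp : ({v} : Finset (Fin n)).card ≤ d + 1) hA.le
  exact ⟨⟨e, hcard⟩, mem_facetsIn.2 heA, Finset.singleton_subset_iff.1 hve⟩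

theorem exists_isPartialSphere_facetsIn (hA : A.card = d + 2) :
    ∃ F : Edge d n, IsPartialSphere (facetsIn d A) F A := by
  obtain ⟨v, hv⟩ : A.Nonempty := Finset.card_pos.1 (by lia)
  obtain ⟨F, hF, -⟩ := exists_mem_facetsIn (by lia : d + 1 < A.card) hv
  exact ⟨F, nonempty_realization_facetsIn_homeomorph_sphere hA, hF, fun v =>
    ⟨exists_mem_facetsIn (by lia), fun ⟨e, he, hve⟩ => mem_facetsIn.1 he hve⟩⟩

theorem minCost_le (W : Edge d n → ℝ) {S : Finset (Edge d n)} (hS : S ∈ spheres d n) :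
    minCost W ≤ cost W S :=
  csInf_le (Set.toFinite _).bddBelow (Set.mem_image_of_mem _ hS)

theorem minCost_nonneg (hW : ∀ e, 0 ≤ W e) : 0 ≤ minCost W := by
  refine Real.sInf_nonneg ?_
  rintro _ ⟨S, -, rfl⟩
  exact Finset.sum_nonneg fun e _ => hW e

theorem exists_minCost_eq (h : (spheres d n).Nonempty) (W : Edge d n → ℝ) :
    ∃ S ∈ spheres d n, minCost W = cost W S := by
  obtain ⟨S, hS, hcost⟩ := (h.image (cost W)).csInf_mem (Set.toFinite _)
  exact ⟨S, hS, hcost.symm⟩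

theorem spheres_nonempty (hd : 1 ≤ d) (hn : d + 2 ≤ n) : (spheres d n).Nonempty := by
  obtain ⟨A, -, hA⟩ := Finset.exists_subset_card_eq (hn.trans_eq (Finset.card_fin n).symm)
  obtain ⟨F, hF⟩ := exists_isPartialSphere_facetsIn hA
  obtain ⟨S, hS, -⟩ := hF.exists_sphere_cost_le hd 0 rfl
  exact ⟨S, hS⟩

theorem cost_facetsIn_sub_le (hA : A.card = d + 2) (hW : ∀ e, W e ≤ 1) {F : Edge d n}
    (hF : F ∈ facetsIn d A) : cost W (facetsIn d A) - W F ≤ d + 1 := by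
  have hcard : ((facetsIn d A).erase F).card = d + 1 := by
    rw [Finset.card_erase_of_mem hF, card_facetsIn, hA, Nat.choose_succ_self_right]
    rfl
  rw [cost, ← Finset.add_sum_erase _ _ hF, add_sub_cancel_left]
  refine (Finset.sum_le_card_nsmul _ _ 1 fun e _ => hW e).trans_eq ?_
  simp [hcard]

theorem exists_minCost_le_insertionCost (hd : 1 ≤ d) (hn : d + 2 ≤ n) :
    ∃ (F : Edge d n) (R : Finset (Fin n)), Disjoint F.1 R ∧ R.card = n - (d + 2) ∧
      ∀ W : Edge d n → ℝ, (∀ e, W e ≤ 1) →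
        ENNReal.ofReal (minCost W) ≤ (d + 2 : ℕ) + insertionCost (n - (d + 2)) F R W := by
  obtain ⟨A, -, hA⟩ := Finset.exists_subset_card_eq (hn.trans_eq (Finset.card_fin n).symm)
  obtain ⟨F, hF⟩ := exists_isPartialSphere_facetsIn hA
  have hR : Aᶜ.card = n - (d + 2) := by rw [Finset.card_compl, hA, Fintype.card_fin]
  refine ⟨F, Aᶜ, disjoint_compl_right.mono_left hF.subset, hR, fun W hW => ?_⟩
  obtain ⟨S, hS, G, -, hle⟩ := hF.exists_sphere_cost_le hd W hR
  have hstart : ENNReal.ofReal (cost W (facetsIn d A) - W F) ≤ (d + 1 : ℕ) :=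
    ENNReal.ofReal_le_natCast.2 (by exact_mod_cast cost_facetsIn_sub_le hA hW hF.mem)
  calc ENNReal.ofReal (minCost W)
      ≤ ENNReal.ofReal (1 + (cost W S - W G)) :=
        ENNReal.ofReal_le_ofReal (by linarith [minCost_le W hS, hW G])
    _ ≤ 1 + ENNReal.ofReal (cost W S - W G) :=
        ENNReal.ofReal_add_le.trans_eq (by rw [ENNReal.ofReal_one])
    _ ≤ 1 + ((d + 1 : ℕ) + insertionCost (n - (d + 2)) F Aᶜ W) := by
        gcongr
        exact hle.trans (by gcongr)
    _ = (d + 2 : ℕ) + insertionCost (n - (d + 2)) F Aᶜ W := by push_cast; ring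

theorem minCost_le_mul (hd : 1 ≤ d) (hn : d + 2 ≤ n) (hW : ∀ e, W e ≤ 1) :
    minCost W ≤ d * n := by
  obtain ⟨F, R, -, hR, hminCost⟩ := exists_minCost_le_insertionCost hd hn
  obtain ⟨r, rfl⟩ := Nat.exists_eq_add_of_le hn
  rw [Nat.add_sub_cancel_left] at hR hminCost
  have hle : ENNReal.ofReal (minCost W) ≤ (d + 2 + d * r : ℕ) :=
    (hminCost W hW).trans (by push_cast; gcongr; exact insertionCost_le hW hR)
  refine (ENNReal.ofReal_le_natCast.1 hle).trans ?_
  norm_cast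
  nlinarith

end MinCost

section CostLaw

variable {d n : ℕ}

instance : IsProbabilityMeasure (volume.restrict (Set.Icc (0 : ℝ) 1)) := ⟨by simp⟩

instance : IsProbabilityMeasure (costLaw d n) := by
  unfold costLaw
  infer_instance

theorem ae_costLaw_mem_Icc (d n : ℕ) : ∀ᵐ W ∂costLaw d n, ∀ e, W e ∈ Set.Icc (0 : ℝ) 1 :=
  ae_all_iff.2 fun e => (measurePreserving_eval _ e).quasiMeasurePreserving.ae
    (ae_restrict_mem measurableSet_Icc)

end CostLaw

section PrekopaLeindler

open scoped Pointwise

theorem volume_add_volume_le_volume_add_of_isCompact {A B : Set ℝ} (hA : IsCompact A)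
    (hB : IsCompact B) (hA' : A.Nonempty) (hB' : B.Nonempty) :
    volume A + volume B ≤ volume (A + B) := by
  obtain ⟨a, ha, hamax⟩ := hA.exists_isGreatest hA'
  obtain ⟨b, hb, hbmin⟩ := hB.exists_isLeast hB'
  have hinter : (b +ᵥ A) ∩ (a +ᵥ B) ⊆ {a + b} := by
    rintro _ ⟨⟨x, hx, rfl⟩, y, hy, hxy⟩
    simp only [vadd_eq_add] at hxy
    simp only [vadd_eq_add, Set.mem_singleton_iff]
    linarith [hamax hx, hbmin hy]
  have hdisj : AEDisjoint volume (b +ᵥ A) (a +ᵥ B) :=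
    measure_mono_null hinter Real.volume_singleton
  calc volume A + volume B = volume (b +ᵥ A) + volume (a +ᵥ B) := by
        rw [measure_vadd, measure_vadd]
    _ = volume ((b +ᵥ A) ∪ (a +ᵥ B)) :=
        (measure_union₀ (hB.measurableSet.const_vadd a).nullMeasurableSet hdisj).symm
    _ ≤ volume (A + B) := by
        refine measure_mono (Set.union_subset ?_ ?_)
        · rintro _ ⟨x, hx, rfl⟩
          exact ⟨x, hx, b, hb, add_comm x b⟩
        · rintro _ ⟨y, hy, rfl⟩
          exact ⟨a, ha, y, hy, rfl⟩

theorem volume_add_volume_le_volume_add {A B : Set ℝ} (hA : MeasurableSet A)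
    (hB : MeasurableSet B) (hA' : A.Nonempty) (hB' : B.Nonempty) :
    volume A + volume B ≤ volume (A + B) := by
  obtain ⟨a, ha⟩ := hA'
  obtain ⟨b, hb⟩ := hB'
  rw [hA.measure_eq_iSup_isCompact, hB.measure_eq_iSup_isCompact]
  simp only [iSup_and']
  refine ENNReal.biSup_add_biSup_le' ⟨∅, A.empty_subset, isCompact_empty⟩
    ⟨∅, B.empty_subset, isCompact_empty⟩ fun K hK L hL => ?_
  calc volume K + volume L
      ≤ volume (insert a K) + volume (insert b L) := by gcongr <;> exact Set.subset_insert _ _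
    _ ≤ volume (insert a K + insert b L) :=
        volume_add_volume_le_volume_add_of_isCompact (hK.2.insert a) (hL.2.insert b)
          (Set.insert_nonempty _ _) (Set.insert_nonempty _ _)
    _ ≤ volume (A + B) := by
        gcongr
        exacts [Set.insert_subset ha hK.1, Set.insert_subset hb hL.1]

theorem volume_add_volume_le_two_mul {A B C : Set ℝ} (hA : MeasurableSet A)
    (hB : MeasurableSet B) (hA' : A.Nonempty) (hB' : B.Nonempty)
    (hC : ∀ x ∈ A, ∀ y ∈ B, (x + y) / 2 ∈ C) : volume A + volume B ≤ 2 * volume C :=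
  calc volume A + volume B ≤ volume (A + B) := volume_add_volume_le_volume_add hA hB hA' hB'
    _ ≤ volume ((fun x => x * 2⁻¹) ⁻¹' C) := by
        refine measure_mono ?_
        rintro _ ⟨x, hx, y, hy, rfl⟩
        exact hC x hx y hy
    _ = 2 * volume C := by
        rw [Real.volume_preimage_mul_right (by norm_num)]
        norm_num

theorem lintegral_eq_lintegral_Ioo_measure_lt {α : Type*} [MeasurableSpace α] (μ : Measure α)
    {f : α → ENNReal} (hf : Measurable f) (hf1 : ∀ x, f x ≤ 1) :
    ∫⁻ x, f x ∂μ = ∫⁻ t in Set.Ioo (0 : ℝ) 1, μ {x | ENNReal.ofReal t < f x} := by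
  have hf_top : ∀ x, f x ≠ ⊤ := fun x => ne_top_of_le_ne_top ENNReal.one_ne_top (hf1 x)
  have hvanish : ∀ t ∈ Set.Ici (1 : ℝ), μ {x | t < (f x).toReal} = 0 := fun t ht => by
    refine measure_mono_null (fun x hx => ?_) measure_empty
    exact (hx.trans_le (ENNReal.toReal_mono ENNReal.one_ne_top (hf1 x))).not_ge ht
  calc ∫⁻ x, f x ∂μ = ∫⁻ x, ENNReal.ofReal (f x).toReal ∂μ := by
        simp only [ENNReal.ofReal_toReal (hf_top _)]
    _ = ∫⁻ t in Set.Ioi (0 : ℝ), μ {x | t < (f x).toReal} :=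
        lintegral_eq_lintegral_meas_lt μ (ae_of_all _ fun _ => ENNReal.toReal_nonneg)
          hf.ennreal_toReal.aemeasurable
    _ = ∫⁻ t in Set.Ioo (0 : ℝ) 1, μ {x | t < (f x).toReal} := by
        rw [← Set.Ioo_union_Ici_eq_Ioi zero_lt_one, lintegral_union measurableSet_Ici
          (Set.disjoint_left.2 fun x hx hx' => hx.2.not_ge hx'),
          setLIntegral_congr_fun measurableSet_Ici hvanish, lintegral_zero, add_zero]
    _ = ∫⁻ t in Set.Ioo (0 : ℝ) 1, μ {x | ENNReal.ofReal t < f x} := by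
        refine setLIntegral_congr_fun measurableSet_Ioo fun t ht => ?_
        simp only [ENNReal.ofReal_lt_iff_lt_toReal ht.1.le (hf_top _)]

variable {p q h : ℝ → ENNReal}

theorem lintegral_add_lintegral_le_of_iSup_eq_one (hp : Measurable p) (hq : Measurable q)
    (hh : Measurable h) (hp1 : ⨆ x, p x = 1) (hq1 : ⨆ x, q x = 1)
    (hpq : ∀ x y, p x * q y ≤ h ((x + y) / 2) ^ 2) :
    (∫⁻ x, p x) + ∫⁻ x, q x ≤ 2 * ∫⁻ x, h x := by
  have hlevel : ∀ t ∈ Set.Ioo (0 : ℝ) 1, volume {x | ENNReal.ofReal t < p x} +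
      volume {x | ENNReal.ofReal t < q x} ≤ 2 * volume {x | ENNReal.ofReal t < min (h x) 1} := by
    intro t ht
    have ht1 : ENNReal.ofReal t < 1 := ENNReal.ofReal_lt_one.2 ht.2
    obtain ⟨x₀, hx₀⟩ := lt_iSup_iff.1 (ht1.trans_eq hp1.symm)
    obtain ⟨y₀, hy₀⟩ := lt_iSup_iff.1 (ht1.trans_eq hq1.symm)
    refine volume_add_volume_le_two_mul (measurableSet_lt measurable_const hp)
      (measurableSet_lt measurable_const hq) ⟨x₀, hx₀⟩ ⟨y₀, hy₀⟩ fun x hx y hy => lt_min ?_ ht1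
    refine lt_of_pow_lt_pow_left' 2 ((pow_two _).trans_lt ?_)
    exact (ENNReal.mul_lt_mul hx hy).trans_le (hpq x y)
  have hmeas : Measurable fun t : ℝ => volume {x | ENNReal.ofReal t < p x} :=
    Antitone.measurable fun s t hst =>
      measure_mono fun x hx => (ENNReal.ofReal_le_ofReal hst).trans_lt hx
  calc (∫⁻ x, p x) + ∫⁻ x, q x
      = ∫⁻ t in Set.Ioo (0 : ℝ) 1, (volume {x | ENNReal.ofReal t < p x} +
          volume {x | ENNReal.ofReal t < q x}) := by
        rw [lintegral_add_left hmeas,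
          lintegral_eq_lintegral_Ioo_measure_lt _ hp fun x => hp1 ▸ le_iSup p x,
          lintegral_eq_lintegral_Ioo_measure_lt _ hq fun x => hq1 ▸ le_iSup q x]
    _ ≤ ∫⁻ t in Set.Ioo (0 : ℝ) 1, 2 * volume {x | ENNReal.ofReal t < min (h x) 1} :=
        setLIntegral_mono' measurableSet_Ioo hlevel
    _ = 2 * ∫⁻ x, min (h x) 1 := by
        rw [lintegral_const_mul' _ _ (by simp), ← lintegral_eq_lintegral_Ioo_measure_lt _
          (hh.min measurable_const) fun x => min_le_right _ _]
    _ ≤ 2 * ∫⁻ x, h x := by gcongr; exact min_le_left _ _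

theorem mul_le_sq_of_add_le_two_mul {a b c : ENNReal} (habc : a + b ≤ 2 * c) :
    a * b ≤ c ^ 2 := by
  rcases eq_or_ne c ⊤ with rfl | hc
  · simp
  have htop : a + b ≠ ⊤ := ne_top_of_le_ne_top (ENNReal.mul_ne_top (by simp) hc) habc
  lift a to NNReal using (ENNReal.add_ne_top.1 htop).1
  lift b to NNReal using (ENNReal.add_ne_top.1 htop).2
  lift c to NNReal using hc
  norm_cast at habc ⊢
  rw [← NNReal.coe_le_coe] at habc ⊢
  push_cast at habc ⊢
  nlinarith [sq_nonneg ((a : ℝ) - b), a.2, b.2, c.2]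

theorem lintegral_mul_lintegral_le_sq_of_iSup_ne_top (hp : Measurable p) (hq : Measurable q)
    (hh : Measurable h) (hp_top : ⨆ x, p x ≠ ⊤) (hq_top : ⨆ x, q x ≠ ⊤)
    (hpq : ∀ x y, p x * q y ≤ h ((x + y) / 2) ^ 2) :
    (∫⁻ x, p x) * ∫⁻ x, q x ≤ (∫⁻ x, h x) ^ 2 := by
  set a := ⨆ x, p x
  set b := ⨆ x, q x
  rcases eq_or_ne a 0 with ha0 | ha0
  · simp [ENNReal.iSup_eq_zero.1 ha0]
  rcases eq_or_ne b 0 with hb0 | hb0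
  · simp [ENNReal.iSup_eq_zero.1 hb0]
  set r := (a * b) ^ (1 / 2 : ℝ) with hr
  have hr2 : r ^ 2 = a * b := by
    rw [hr, ← ENNReal.rpow_natCast, ← ENNReal.rpow_mul]
    norm_num
  have hr0 : r ≠ 0 := fun h0 => mul_ne_zero ha0 hb0 (by rw [← hr2, h0, sq, zero_mul])
  have hr_top : r ≠ ⊤ := ENNReal.rpow_ne_top_of_nonneg (by norm_num)
    (ENNReal.mul_ne_top hp_top hq_top)
  have hnormalized : a⁻¹ * (∫⁻ x, p x) + b⁻¹ * ∫⁻ x, q x ≤ 2 * (r⁻¹ * ∫⁻ x, h x) := by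
    rw [← lintegral_const_mul _ hp, ← lintegral_const_mul _ hq, ← lintegral_const_mul _ hh]
    refine lintegral_add_lintegral_le_of_iSup_eq_one (hp.const_mul _) (hq.const_mul _)
      (hh.const_mul _) ?_ ?_ fun x y => ?_
    · rw [← ENNReal.mul_iSup, ENNReal.inv_mul_cancel ha0 hp_top]
    · rw [← ENNReal.mul_iSup, ENNReal.inv_mul_cancel hb0 hq_top]
    · rw [mul_mul_mul_comm, ← ENNReal.mul_inv (.inl ha0) (.inl hp_top), ← hr2, mul_pow,
        ENNReal.inv_pow]
      gcongr
      exact hpq x y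
  have hproduct := mul_le_sq_of_add_le_two_mul hnormalized
  rw [mul_mul_mul_comm, ← ENNReal.mul_inv (.inl ha0) (.inl hp_top), ← hr2, mul_pow,
    ENNReal.inv_pow] at hproduct
  exact (ENNReal.mul_le_mul_iff_right (pow_ne_zero 2 (ENNReal.inv_ne_zero.2 hr_top))
    (ENNReal.pow_ne_top (ENNReal.inv_ne_top.2 hr0))).1 hproduct

theorem lintegral_eq_iSup_lintegral_min {α : Type*} [MeasurableSpace α] (μ : Measure α)
    {f : α → ENNReal} (hf : Measurable f) : ∫⁻ x, f x ∂μ = ⨆ k : ℕ, ∫⁻ x, min (f x) k ∂μ := by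
  rw [← lintegral_iSup (fun k => hf.min measurable_const)
    fun k l hkl x => min_le_min_left _ (by exact_mod_cast hkl)]
  exact lintegral_congr fun x => by rw [← inf_iSup_eq, ENNReal.iSup_natCast, inf_top_eq]

/-- The Prékopa–Leindler inequality on the line, with equal weights. -/
theorem lintegral_mul_lintegral_le_sq (hp : Measurable p) (hq : Measurable q) (hh : Measurable h)
    (hpq : ∀ x y, p x * q y ≤ h ((x + y) / 2) ^ 2) :
    (∫⁻ x, p x) * ∫⁻ x, q x ≤ (∫⁻ x, h x) ^ 2 := by
  have iSup_min_ne_top : ∀ (f : ℝ → ENNReal) (k : ℕ), ⨆ x, min (f x) k ≠ ⊤ := fun f k =>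
    ne_top_of_le_ne_top (ENNReal.natCast_ne_top k) (iSup_le fun x => min_le_right _ _)
  rw [lintegral_eq_iSup_lintegral_min _ hp, lintegral_eq_iSup_lintegral_min _ hq,
    ENNReal.iSup_mul]
  refine iSup_le fun k => ?_
  rw [ENNReal.mul_iSup]
  exact iSup_le fun l => lintegral_mul_lintegral_le_sq_of_iSup_ne_top (hp.min measurable_const)
    (hq.min measurable_const) hh (iSup_min_ne_top p k) (iSup_min_ne_top q l)
    fun x y => (mul_le_mul' (min_le_left _ _) (min_le_left _ _)).trans (hpq x y)

end PrekopaLeindler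

section PropertyTau

/-- Maurey's property (τ) of the measure `μ`, written with the exponential `c` of the cost function;
the free factor `K` is what makes the property pass to products. -/
def PropertyTau {α : Type*} [MeasurableSpace α] (μ : Measure α) (c : α → α → ENNReal) : Prop :=
  ∀ ⦃f g : α → ENNReal⦄ ⦃K : ENNReal⦄, Measurable f → Measurable g →
    (∀ x y, f x * g y ≤ K * c x y) → (∫⁻ x, f x ∂μ) * ∫⁻ x, g x ∂μ ≤ K

theorem PropertyTau.lmarginal_mul_le {ι : Type*} [Fintype ι] [DecidableEq ι] {α : ι → Type*}
    [∀ i, MeasurableSpace (α i)] {μ : ∀ i, Measure (α i)} [∀ i, SigmaFinite (μ i)]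
    {c : ∀ i, α i → α i → ENNReal} (hμ : ∀ i, PropertyTau (μ i) (c i))
    {f g : (∀ i, α i) → ENNReal} (hf : Measurable f) (hg : Measurable g) {K : ENNReal}
    (hfg : ∀ x y, f x * g y ≤ K * ∏ i, c i (x i) (y i)) (s : Finset ι) (x y : ∀ i, α i) :
    lmarginal μ s f x * lmarginal μ s g y ≤ K * ∏ i ∈ sᶜ, c i (x i) (y i) := by
  induction s using Finset.induction generalizing x y with
  | empty => simpa using hfg x y
  | insert i s hi ih =>
    rw [lmarginal_insert f hf hi, lmarginal_insert g hg hi]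
    refine hμ i ((hf.lmarginal μ).comp (measurable_update x))
      ((hg.lmarginal μ).comp (measurable_update y)) fun u v => (ih _ _).trans_eq ?_
    have hcompl : sᶜ = insert i (insert i s)ᶜ := by
      ext j
      by_cases hj : j = i <;> simp [hj, hi]
    have hother : ∏ j ∈ (insert i s)ᶜ, c j (Function.update x i u j) (Function.update y i v j) =
        ∏ j ∈ (insert i s)ᶜ, c j (x j) (y j) := by
      refine Finset.prod_congr rfl fun j hj => ?_
      have hji : j ≠ i := by rintro rfl; simp at hj
      simp only [Function.update_of_ne hji]
    rw [hcompl, Finset.prod_insert (by simp), hother, Function.update_self, Function.update_self,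
      mul_comm (c i u v), mul_assoc]

theorem PropertyTau.pi {ι : Type*} [Fintype ι] {α : ι → Type*} [∀ i, MeasurableSpace (α i)]
    {μ : ∀ i, Measure (α i)} [∀ i, SigmaFinite (μ i)] {c : ∀ i, α i → α i → ENNReal}
    (hμ : ∀ i, PropertyTau (μ i) (c i)) :
    PropertyTau (Measure.pi μ) fun x y => ∏ i, c i (x i) (y i) := by
  classical
  intro f g K hf hg hfg
  rcases isEmpty_or_nonempty (∀ i, α i) with _ | ⟨⟨x⟩⟩
  · simp [lintegral_of_isEmpty]
  · simpa using PropertyTau.lmarginal_mul_le hμ hf hg hfg Finset.univ x x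

theorem one_add_indicator_mul_le {α : Type*} {A B : Set α} {e : ENNReal} {c : α → α → ENNReal}
    (hc : ∀ x y, 1 ≤ c x y) (hAB : ∀ x ∈ A, ∀ y ∈ B, 1 + e ≤ c x y) (x y : α) :
    (1 + A.indicator (fun _ => e) x) * (1 + B.indicator (fun _ => e) y) ≤ (1 + e) * c x y := by
  have hle : ∀ (A : Set α) (x : α), 1 + A.indicator (fun _ => e) x ≤ 1 + e := fun A x => by
    gcongr
    exact Set.indicator_le_self' (fun _ _ => zero_le) x
  by_cases hx : x ∈ A
  · by_cases hy : y ∈ B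
    · rw [Set.indicator_of_mem hx, Set.indicator_of_mem hy]
      gcongr
      exact hAB x hx y hy
    · rw [Set.indicator_of_notMem hy, add_zero]
      exact mul_le_mul' (hle A x) (hc x y)
  · rw [Set.indicator_of_notMem hx, add_zero, mul_comm]
    exact mul_le_mul' (hle B y) (hc x y)

theorem lintegral_one_add_indicator {α : Type*} [MeasurableSpace α] {μ : Measure α}
    [IsProbabilityMeasure μ] {A : Set α} (hA : MeasurableSet A) {r : ℝ} (hr : 0 ≤ r) :
    ∫⁻ x, (1 + A.indicator (fun _ => ENNReal.ofReal r) x) ∂μ =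
      ENNReal.ofReal (1 + r * μ.real A) := by
  rw [lintegral_add_left measurable_const, lintegral_indicator_const hA,
    ENNReal.ofReal_add zero_le_one (mul_nonneg hr measureReal_nonneg), ENNReal.ofReal_mul hr,
    ofReal_measureReal, lintegral_one, measure_univ, ENNReal.ofReal_one]

/-- Apply property (τ) to the functions that are `E` on `A`, respectively `B`, and `1` elsewhere. -/
theorem PropertyTau.measureReal_mul_le {α : Type*} [MeasurableSpace α] {μ : Measure α}
    [IsProbabilityMeasure μ] {c : α → α → ENNReal} (hμ : PropertyTau μ c)
    (hc : ∀ x y, 1 ≤ c x y) {A B : Set α} (hA : MeasurableSet A) (hB : MeasurableSet B) {E : ℝ}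
    (hE : 1 < E) (hAB : ∀ x ∈ A, ∀ y ∈ B, ENNReal.ofReal E ≤ c x y) :
    μ.real A * μ.real B * E ≤ (1 - μ.real A) * (1 - μ.real B) := by
  have hr : 0 ≤ E - 1 := by linarith
  have hone_add : 1 + ENNReal.ofReal (E - 1) = ENNReal.ofReal E := by
    rw [← ENNReal.ofReal_one, ← ENNReal.ofReal_add zero_le_one hr, add_sub_cancel]
  have htau := hμ ((measurable_const.indicator hA).const_add _)
    ((measurable_const.indicator hB).const_add _)
    (one_add_indicator_mul_le hc (by rwa [hone_add]))
  rw [hone_add, lintegral_one_add_indicator hA hr, lintegral_one_add_indicator hB hr,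
    ← ENNReal.ofReal_mul (add_nonneg zero_le_one (mul_nonneg hr measureReal_nonneg)),
    ENNReal.ofReal_le_ofReal_iff (by linarith)] at htau
  refine le_of_mul_le_mul_left ?_ (sub_pos.2 hE)
  linarith

end PropertyTau

section UniformLaw

theorem lintegral_Icc_eq_two_mul_lintegral_sq (f : ℝ → ENNReal) :
    ∫⁻ x in Set.Icc (0 : ℝ) 1, f x =
      2 * ∫⁻ u in Set.Icc (0 : ℝ) 1, ENNReal.ofReal u * f (u ^ 2) := by
  have himage : (fun u : ℝ => u ^ 2) '' Set.Icc 0 1 = Set.Icc 0 1 := by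
    refine Set.Subset.antisymm ?_ fun x hx =>
      ⟨√x, ⟨Real.sqrt_nonneg x, Real.sqrt_le_one.2 hx.2⟩, Real.sq_sqrt hx.1⟩
    rintro _ ⟨u, hu, rfl⟩
    exact ⟨sq_nonneg u, pow_le_one₀ hu.1 hu.2⟩
  have hinj : Set.InjOn (fun u : ℝ => u ^ 2) (Set.Icc 0 1) :=
    fun u hu v hv => (pow_left_inj₀ hu.1 hv.1 two_ne_zero).1
  rw [← lintegral_const_mul' _ _ (by simp)]
  conv_lhs => rw [← himage]
  rw [lintegral_image_eq_lintegral_abs_deriv_mul measurableSet_Icc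
    (fun u _ => (hasDerivAt_pow 2 u).hasDerivWithinAt) hinj]
  refine setLIntegral_congr_fun measurableSet_Icc fun u hu => ?_
  have habs : |((2 : ℕ) : ℝ) * u ^ (2 - 1)| = 2 * u := by simp [abs_of_nonneg hu.1]
  rw [habs, ENNReal.ofReal_mul zero_le_two, ENNReal.ofReal_ofNat, mul_assoc]

theorem mul_mul_exp_le {u v : ℝ} (hu : u ∈ Set.Icc (0 : ℝ) 1) (hv : v ∈ Set.Icc (0 : ℝ) 1) :
    u * v * Real.exp ((u - v) ^ 2 / 4) ≤ ((u + v) / 2) ^ 2 := by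
  have hmean : ((u + v) / 2) ^ 2 ≤ 1 :=
    pow_le_one₀ (by linarith [hu.1, hv.1]) (by linarith [hu.2, hv.2])
  have hexp : 1 - (u - v) ^ 2 / 4 ≤ Real.exp (-((u - v) ^ 2 / 4)) := by
    linarith [Real.add_one_le_exp (-((u - v) ^ 2 / 4))]
  calc u * v * Real.exp ((u - v) ^ 2 / 4)
      ≤ ((u + v) / 2) ^ 2 * (1 - (u - v) ^ 2 / 4) * Real.exp ((u - v) ^ 2 / 4) := by
        refine mul_le_mul_of_nonneg_right ?_ (Real.exp_pos _).le
        nlinarith [sq_nonneg (u - v)]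
    _ ≤ ((u + v) / 2) ^ 2 * Real.exp (-((u - v) ^ 2 / 4)) * Real.exp ((u - v) ^ 2 / 4) := by
        gcongr
    _ = ((u + v) / 2) ^ 2 := by rw [mul_assoc, ← Real.exp_add]; simp

/-- The factor by which property (τ) holds for the uniform law in the metric `|√x - √y|`. -/
def sqrtCost (x y : ℝ) : ENNReal := ENNReal.ofReal (Real.exp ((√x - √y) ^ 2 / 4))

/-- The integrand of `∫ f` over `[0, 1]` after the substitution `x = u ^ 2`, up to a factor `2`. -/
def sqIntegrand (f : ℝ → ENNReal) : ℝ → ENNReal :=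
  (Set.Icc (0 : ℝ) 1).indicator fun u => ENNReal.ofReal u * f (u ^ 2)

theorem measurable_sqIntegrand {f : ℝ → ENNReal} (hf : Measurable f) :
    Measurable (sqIntegrand f) :=
  (ENNReal.measurable_ofReal.mul (hf.comp (measurable_id.pow_const 2))).indicator measurableSet_Icc

theorem lintegral_Icc_eq_two_mul_lintegral_sqIntegrand (f : ℝ → ENNReal) :
    ∫⁻ x in Set.Icc (0 : ℝ) 1, f x = 2 * ∫⁻ u, sqIntegrand f u := by
  rw [lintegral_Icc_eq_two_mul_lintegral_sq, ← lintegral_indicator measurableSet_Icc]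
  rfl

theorem sqIntegrand_mul_le {f g : ℝ → ENNReal} {K : ENNReal}
    (hfg : ∀ x y, f x * g y ≤ K ^ 2 * sqrtCost x y) (u v : ℝ) :
    sqIntegrand f u * sqIntegrand g v ≤ sqIntegrand (fun _ => K) ((u + v) / 2) ^ 2 := by
  by_cases hu : u ∈ Set.Icc (0 : ℝ) 1
  swap
  · simp [sqIntegrand, hu]
  by_cases hv : v ∈ Set.Icc (0 : ℝ) 1
  swap
  · simp [sqIntegrand, hv]
  have huv : (u + v) / 2 ∈ Set.Icc (0 : ℝ) 1 :=
    ⟨by linarith [hu.1, hv.1], by linarith [hu.2, hv.2]⟩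
  have hfg := hfg (u ^ 2) (v ^ 2)
  rw [sqrtCost, Real.sqrt_sq hu.1, Real.sqrt_sq hv.1] at hfg
  simp only [sqIntegrand, Set.indicator_of_mem hu, Set.indicator_of_mem hv,
    Set.indicator_of_mem huv]
  calc ENNReal.ofReal u * f (u ^ 2) * (ENNReal.ofReal v * g (v ^ 2))
      ≤ ENNReal.ofReal u * ENNReal.ofReal v *
          (K ^ 2 * ENNReal.ofReal (Real.exp ((u - v) ^ 2 / 4))) := by
        rw [mul_mul_mul_comm]
        gcongr
    _ = ENNReal.ofReal (u * v * Real.exp ((u - v) ^ 2 / 4)) * K ^ 2 := by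
        rw [ENNReal.ofReal_mul (mul_nonneg hu.1 hv.1), ENNReal.ofReal_mul hu.1]
        ring
    _ ≤ ENNReal.ofReal (((u + v) / 2) ^ 2) * K ^ 2 := by
        gcongr
        exact mul_mul_exp_le hu hv
    _ = (ENNReal.ofReal ((u + v) / 2) * K) ^ 2 := by rw [mul_pow, ENNReal.ofReal_pow huv.1]

/-- If `x` is uniform in `[0, 1]`, then `√x` has the log-concave density `2 u`. -/
theorem propertyTau_uniform : PropertyTau (volume.restrict (Set.Icc (0 : ℝ) 1)) sqrtCost := by
  intro f g K hf hg hfg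
  obtain ⟨k, rfl⟩ : ∃ k : ENNReal, k ^ 2 = K :=
    ⟨K ^ (1 / 2 : ℝ), by rw [← ENNReal.rpow_natCast, ← ENNReal.rpow_mul]; norm_num⟩
  calc (∫⁻ x in Set.Icc (0 : ℝ) 1, f x) * ∫⁻ x in Set.Icc (0 : ℝ) 1, g x
      = 2 ^ 2 * ((∫⁻ u, sqIntegrand f u) * ∫⁻ u, sqIntegrand g u) := by
        simp only [lintegral_Icc_eq_two_mul_lintegral_sqIntegrand]
        ring
    _ ≤ 2 ^ 2 * (∫⁻ u, sqIntegrand (fun _ => k) u) ^ 2 := by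
        gcongr
        exact lintegral_mul_lintegral_le_sq (measurable_sqIntegrand hf) (measurable_sqIntegrand hg)
          (measurable_sqIntegrand measurable_const) (sqIntegrand_mul_le hfg)
    _ = k ^ 2 := by
        rw [← mul_pow, ← lintegral_Icc_eq_two_mul_lintegral_sqIntegrand, lintegral_const,
          measure_univ, mul_one]

end UniformLaw

section Concentration

/-- The isoperimetric inequality between the level sets of `X` satisfied by a nonnegative random
variable `X` whose square root is `1`-Lipschitz in the square roots of independent uniform
variables. -/
def SqrtIsoperimetry {Ω : Type*} [MeasurableSpace Ω] (P : Measure Ω) (X : Ω → ℝ) : Prop :=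
  ∀ ⦃a b : ℝ⦄, 0 ≤ a → a < b →
    P.real {ω | X ω ≤ a} * P.real {ω | b ≤ X ω} * Real.exp ((√b - √a) ^ 2 / 4) ≤
      (1 - P.real {ω | X ω ≤ a}) * (1 - P.real {ω | b ≤ X ω})

theorem one_le_sqrtCost (x y : ℝ) : 1 ≤ sqrtCost x y :=
  ENNReal.one_le_ofReal.2 (Real.one_le_exp (by positivity))

theorem prod_sqrtCost {ι : Type*} [Fintype ι] (x y : ι → ℝ) :
    ∏ i, sqrtCost (x i) (y i) =
      ENNReal.ofReal (Real.exp ((∑ i, (√(x i) - √(y i)) ^ 2) / 4)) := by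
  rw [Finset.sum_div, Real.exp_sum, ENNReal.ofReal_prod_of_nonneg fun i _ => (Real.exp_pos _).le]
  rfl

theorem sqrtIsoperimetry_pi_uniform {ι : Type*} [Fintype ι] {X : (ι → ℝ) → ℝ} (hX : Measurable X)
    (hlip : ∀ x y : ι → ℝ, (∀ i, 0 ≤ x i) → (∀ i, 0 ≤ y i) →
      √(X y) ≤ √(X x) + √(∑ i, (√(x i) - √(y i)) ^ 2)) :
    SqrtIsoperimetry (Measure.pi fun _ : ι => volume.restrict (Set.Icc (0 : ℝ) 1)) X := by
  intro a b ha hab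
  set P := Measure.pi fun _ : ι => volume.restrict (Set.Icc (0 : ℝ) 1)
  have hsqrt : √a < √b := Real.sqrt_lt_sqrt ha hab
  have hnonneg : ∀ᵐ x ∂P, x ∈ Set.Ici (0 : ι → ℝ) := by
    refine ae_all_iff.2 fun i => ?_
    have hi : ∀ᵐ t ∂volume.restrict (Set.Icc (0 : ℝ) 1), 0 ≤ t :=
      (ae_restrict_mem measurableSet_Icc).mono fun t ht => ht.1
    exact (Measure.quasiMeasurePreserving_eval _ i).ae hi
  have hinter : ∀ A : Set (ι → ℝ), P.real (A ∩ Set.Ici 0) = P.real A := fun A =>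
    measureReal_congr (inter_ae_eq_left_of_ae_eq_univ (eventuallyEq_univ.2 hnonneg))
  have hsep : ∀ x ∈ {x | X x ≤ a} ∩ Set.Ici 0, ∀ y ∈ {y | b ≤ X y} ∩ Set.Ici 0,
      ENNReal.ofReal (Real.exp ((√b - √a) ^ 2 / 4)) ≤ ∏ i, sqrtCost (x i) (y i) := by
    rintro x ⟨hxa, hx⟩ y ⟨hby, hy⟩
    have hdist : √b - √a ≤ √(∑ i, (√(x i) - √(y i)) ^ 2) := by
      linarith [hlip x y hx hy, Real.sqrt_le_sqrt hxa, Real.sqrt_le_sqrt hby]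
    rw [prod_sqrtCost]
    gcongr
    exact (Real.le_sqrt' (by linarith)).1 hdist
  rw [← hinter {x | X x ≤ a}, ← hinter {y | b ≤ X y}]
  exact (PropertyTau.pi fun _ : ι => propertyTau_uniform).measureReal_mul_le
    (fun x y => Finset.one_le_prod'' fun i => one_le_sqrtCost _ _)
    ((measurableSet_le hX measurable_const).inter measurableSet_Ici)
    ((measurableSet_le measurable_const hX).inter measurableSet_Ici)
    (Real.one_lt_exp_iff.2 (by have := sub_pos.2 hsqrt; positivity)) hsep

theorem le_half_mul_exp_of_isoperimetry {α γ x : ℝ} (hα : 1 / 2 ≤ α) (hγ₀ : 0 ≤ γ) (hγ₁ : γ ≤ 1)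
    (h : α * γ * Real.exp x ≤ (1 - α) * (1 - γ)) : γ ≤ 1 / 2 * Real.exp (-(x / 2)) := by
  have hE : Real.exp x = Real.exp (x / 2) ^ 2 := by rw [← Real.exp_nat_mul]; congr 1; ring
  rw [Real.exp_neg, ← div_eq_mul_inv, le_div_iff₀ (Real.exp_pos _)]
  rw [hE] at h
  set E := Real.exp (x / 2)
  have hodds : γ * E ^ 2 ≤ 1 - γ := by
    have hleft : 1 / 2 * (γ * E ^ 2) ≤ α * (γ * E ^ 2) := by gcongr
    have hright : (1 - α) * (1 - γ) ≤ 1 / 2 * (1 - γ) :=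
      mul_le_mul_of_nonneg_right (by linarith) (by linarith)
    linarith
  nlinarith [mul_nonneg hγ₀ (sq_nonneg (E - 1))]

theorem sq_sub_div_le_sq_sqrt_sub_sqrt {a b c : ℝ} (ha : 0 ≤ a) (hab : a < b) (hbc : b ≤ c) :
    (b - a) ^ 2 / (4 * c) ≤ (√b - √a) ^ 2 := by
  have ha' := Real.sq_sqrt ha
  have hb' := Real.sq_sqrt (ha.trans hab.le)
  rw [div_le_iff₀ (by linarith)]
  calc (b - a) ^ 2 = (√b - √a) ^ 2 * (√b + √a) ^ 2 := by
        rw [← mul_pow, mul_comm, ← sq_sub_sq, ha', hb']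
    _ ≤ (√b - √a) ^ 2 * (4 * c) := by
        gcongr
        nlinarith [sq_nonneg (√b - √a)]

variable {Ω : Type*} [MeasurableSpace Ω] {P : Measure Ω} {X : Ω → ℝ}

theorem SqrtIsoperimetry.measureReal_ge_le [IsProbabilityMeasure P] (hX : SqrtIsoperimetry P X)
    {a b : ℝ} (ha : 0 ≤ a) (hab : a < b) (hP : 1 / 2 ≤ P.real {ω | X ω ≤ a}) :
    P.real {ω | b ≤ X ω} ≤ 1 / 2 * Real.exp (-((√b - √a) ^ 2 / 8)) := by
  convert le_half_mul_exp_of_isoperimetry hP measureReal_nonneg measureReal_le_one (hX ha hab)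
    using 3
  ring

theorem SqrtIsoperimetry.measureReal_le_le [IsProbabilityMeasure P] (hX : SqrtIsoperimetry P X)
    {a b : ℝ} (ha : 0 ≤ a) (hab : a < b) (hP : 1 / 2 ≤ P.real {ω | b ≤ X ω}) :
    P.real {ω | X ω ≤ a} ≤ 1 / 2 * Real.exp (-((√b - √a) ^ 2 / 8)) := by
  have h := hX ha hab
  rw [mul_comm (P.real _), mul_comm (1 - _)] at h
  convert le_half_mul_exp_of_isoperimetry hP measureReal_nonneg measureReal_le_one h using 3
  ring

theorem frequently_ae_of_measureReal_pos {s : Set Ω} (hs : 0 < P.real s) : ∃ᵐ ω ∂P, ω ∈ s :=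
  frequently_ae_mem_iff.2 fun h => by simp [measureReal_def, h] at hs

theorem IsMedian.mem_Icc {μ B : ℝ} (hμ : IsMedian P X μ) (hX : ∀ᵐ ω ∂P, X ω ∈ Set.Icc 0 B) :
    μ ∈ Set.Icc 0 B := by
  obtain ⟨ω, hω, hωX⟩ :=
    ((frequently_ae_of_measureReal_pos (one_half_pos.trans_le hμ.1)).and_eventually hX).exists
  obtain ⟨ω', hω', hωX'⟩ :=
    ((frequently_ae_of_measureReal_pos (one_half_pos.trans_le hμ.2)).and_eventually hX).exists
  exact ⟨hωX.1.trans hω, hω'.trans hωX'.2⟩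

theorem exp_neg_sq_sqrt_sub_sqrt_le {a b B : ℝ} (ha : 0 ≤ a) (hab : a < b) (hb : b ≤ B) :
    Real.exp (-((√b - √a) ^ 2 / 8)) ≤ Real.exp (-((b - a) ^ 2 / (32 * B))) := by
  refine Real.exp_le_exp.2 (neg_le_neg ?_)
  calc (b - a) ^ 2 / (32 * B) = (b - a) ^ 2 / (4 * B) / 8 := by ring
    _ ≤ (√b - √a) ^ 2 / 8 := by gcongr; exact sq_sub_div_le_sq_sqrt_sub_sqrt ha hab hb

theorem SqrtIsoperimetry.upper_tail [IsProbabilityMeasure P] (hiso : SqrtIsoperimetry P X)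
    {μ B t : ℝ} (hX : ∀ᵐ ω ∂P, X ω ∈ Set.Icc 0 B) (hμ : IsMedian P X μ) (ht : 0 < t) :
    P.real {ω | μ + t ≤ X ω} ≤ 1 / 2 * Real.exp (-(t ^ 2 / (32 * B))) := by
  by_cases hB : μ + t ≤ B
  · have hμ₀ := (hμ.mem_Icc hX).1
    refine (hiso.measureReal_ge_le hμ₀ (by linarith) hμ.1).trans ?_
    gcongr 1 / 2 * ?_
    simpa using exp_neg_sq_sqrt_sub_sqrt_le hμ₀ (lt_add_of_pos_right μ ht) hB
  · have hnull : P {ω | μ + t ≤ X ω} = 0 :=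
      measure_eq_zero_iff_ae_notMem.2 (hX.mono fun ω hω h => hB (h.trans hω.2))
    rw [measureReal_def, hnull]
    positivity

theorem SqrtIsoperimetry.lower_tail [IsProbabilityMeasure P] (hiso : SqrtIsoperimetry P X)
    {μ B t : ℝ} (hX : ∀ᵐ ω ∂P, X ω ∈ Set.Icc 0 B) (hμ : IsMedian P X μ) (ht : 0 < t) :
    P.real {ω | X ω ≤ μ - t} ≤ 1 / 2 * Real.exp (-(t ^ 2 / (32 * B))) := by
  by_cases h₀ : 0 ≤ μ - t
  · refine (hiso.measureReal_le_le h₀ (by linarith) hμ.2).trans ?_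
    gcongr 1 / 2 * ?_
    simpa using exp_neg_sq_sqrt_sub_sqrt_le h₀ (sub_lt_self μ ht) (hμ.mem_Icc hX).2
  · have hnull : P {ω | X ω ≤ μ - t} = 0 :=
      measure_eq_zero_iff_ae_notMem.2 (hX.mono fun ω hω h => h₀ (hω.1.trans h))
    rw [measureReal_def, hnull]
    positivity

theorem SqrtIsoperimetry.concentration [IsProbabilityMeasure P] (hiso : SqrtIsoperimetry P X)
    {μ B t : ℝ} (hX : ∀ᵐ ω ∂P, X ω ∈ Set.Icc 0 B) (hμ : IsMedian P X μ) (ht : 0 < t) :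
    P.real {ω | t < |X ω - μ|} ≤ Real.exp (-(t ^ 2 / (32 * B))) := by
  have hsub : {ω | t < |X ω - μ|} ⊆ {ω | μ + t ≤ X ω} ∪ {ω | X ω ≤ μ - t} := 
    fun ω (hω : t < |X ω - μ|) => (lt_abs.1 hω).imp
      (fun h => show μ + t ≤ X ω by linarith) fun h => show X ω ≤ μ - t by linarith
  linarith [(measureReal_mono hsub (μ := P)).trans (measureReal_union_le _ _),
    hiso.upper_tail hX hμ ht, hiso.lower_tail hX hμ ht]

end Concentration

section MinCostConcentration

variable {d n : ℕ}

theorem sqrt_sum_le_sqrt_sum_add {ι : Type*} (S : Finset ι) {x y : ι → ℝ} (hx : ∀ i, 0 ≤ x i)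
    (hy : ∀ i, 0 ≤ y i) :
    √(∑ i ∈ S, y i) ≤ √(∑ i ∈ S, x i) + √(∑ i ∈ S, (√(x i) - √(y i)) ^ 2) := by
  let root (z : ι → ℝ) : EuclideanSpace ℝ S := WithLp.toLp 2 fun i => √(z i)
  have hnorm : ∀ z : ι → ℝ, (∀ i, 0 ≤ z i) → ‖root z‖ = √(∑ i ∈ S, z i) := fun z hz => by
    simp [root, EuclideanSpace.norm_eq, Real.sq_sqrt (hz _), Finset.sum_attach S z]
  have hdist : ‖root x - root y‖ = √(∑ i ∈ S, (√(x i) - √(y i)) ^ 2) := by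
    simp [root, EuclideanSpace.norm_eq, Finset.sum_attach S fun i => (√(x i) - √(y i)) ^ 2]
  rw [← hnorm x hx, ← hnorm y hy, ← hdist, norm_sub_rev]
  exact norm_le_insert' _ _

theorem sqrt_cost_le {W W' : Edge d n → ℝ} (hW : ∀ e, 0 ≤ W e) (hW' : ∀ e, 0 ≤ W' e)
    (S : Finset (Edge d n)) :
    √(cost W' S) ≤ √(cost W S) + √(∑ e, (√(W e) - √(W' e)) ^ 2) := by
  refine (sqrt_sum_le_sqrt_sum_add S hW hW').trans ?_
  gcongr
  exacts [le_rfl, S.subset_univ]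

theorem sqrt_minCost_le (h : (spheres d n).Nonempty) {W W' : Edge d n → ℝ} (hW : ∀ e, 0 ≤ W e)
    (hW' : ∀ e, 0 ≤ W' e) :
    √(minCost W') ≤ √(minCost W) + √(∑ e, (√(W e) - √(W' e)) ^ 2) := by
  obtain ⟨S, hS, hmin⟩ := exists_minCost_eq h W
  rw [hmin]
  exact (Real.sqrt_le_sqrt (minCost_le W' hS)).trans (sqrt_cost_le hW hW' S)

theorem measurable_minCost : Measurable (minCost : (Edge d n → ℝ) → ℝ) := by
  have hcost : ∀ S : Finset (Edge d n), Measurable fun W => cost W S := fun S =>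
    Finset.measurable_fun_sum S fun e _ => measurable_pi_apply e
  unfold minCost
  simp only [sInf_image']
  exact Measurable.iInf fun S => hcost S

theorem sqrtIsoperimetry_minCost (h : (spheres d n).Nonempty) :
    SqrtIsoperimetry (costLaw d n) minCost :=
  sqrtIsoperimetry_pi_uniform measurable_minCost fun _ _ hW hW' => sqrt_minCost_le h hW hW'

theorem minCost_concentration (hd : 1 ≤ d) (hn : d + 2 ≤ n) {μ : ℝ}
    (hμ : IsMedian (costLaw d n) minCost μ) {t : ℝ} (ht : 0 < t) :
    (costLaw d n).real {W | t < |minCost W - μ|} ≤ Real.exp (-(1 / (32 * d) * t ^ 2 / n)) := by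
  have hmem : ∀ᵐ W ∂costLaw d n, minCost W ∈ Set.Icc (0 : ℝ) (d * n) := by
    filter_upwards [ae_costLaw_mem_Icc d n] with W hW
    exact ⟨minCost_nonneg fun e => (hW e).1, minCost_le_mul hd hn fun e => (hW e).2⟩
  convert (sqrtIsoperimetry_minCost (spheres_nonempty hd hn)).concentration hmem hμ ht using 3
  ring

end MinCostConcentration

section LowerBound

theorem tendsto_measure_one_of_measureReal_compl_le {Ω : ℕ → Type*} [∀ n, MeasurableSpace (Ω n)]
    {P : ∀ n, Measure (Ω n)} [∀ n, IsProbabilityMeasure (P n)] {A : ∀ n, Set (Ω n)} {u : ℕ → ℝ}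
    (hu : Tendsto u atTop (𝓝 0)) (hA : ∀ᶠ n in atTop, (P n).real (A n)ᶜ ≤ u n) :
    Tendsto (fun n => P n (A n)) atTop (𝓝 1) := by
  have hlower : Tendsto (fun n => ENNReal.ofReal (1 - u n)) atTop (𝓝 1) := by
    simpa using ENNReal.tendsto_ofReal (hu.const_sub 1)
  refine tendsto_of_tendsto_of_tendsto_of_le_of_le' hlower tendsto_const_nhds ?_
    (Eventually.of_forall fun n => prob_le_one)
  filter_upwards [hA] with n hn
  have hunion := measureReal_union_le (μ := P n) (A n) (A n)ᶜ
  rw [Set.union_compl_self, probReal_univ] at hunion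
  rw [← ofReal_measureReal]
  exact ENNReal.ofReal_le_ofReal (by linarith)

theorem mgf_uniform_neg_le {l : ℝ} (hl : 0 < l) :
    ProbabilityTheory.mgf id (volume.restrict (Set.Icc (0 : ℝ) 1)) (-l) ≤ l⁻¹ := by
  have hint : ∫ x in (0 : ℝ)..1, Real.exp (-l * x) = l⁻¹ * (1 - Real.exp (-l)) := by
    rw [intervalIntegral.integral_comp_mul_left _ (neg_ne_zero.2 hl.ne'), integral_exp]
    simp only [mul_one, mul_zero, Real.exp_zero, smul_eq_mul, inv_neg]
    ring
  rw [ProbabilityTheory.mgf, integral_Icc_eq_integral_Ioc,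
    ← intervalIntegral.integral_of_le zero_le_one]
  simp only [id_eq, hint]
  exact mul_le_of_le_one_right (inv_nonneg.2 hl.le) (by linarith [Real.exp_pos (-l)])

theorem iIndepFun_pi_uniform (ι : Type*) [Fintype ι] :
    ProbabilityTheory.iIndepFun (fun i (x : ι → ℝ) => x i)
      (Measure.pi fun _ => volume.restrict (Set.Icc (0 : ℝ) 1)) :=
  ProbabilityTheory.iIndepFun_pi (X := fun _ => id) fun _ => aemeasurable_id

theorem mgf_sum_pi_uniform_neg_le {ι : Type*} [Fintype ι] (S : Finset ι) {l : ℝ} (hl : 0 < l) :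
    ProbabilityTheory.mgf (∑ i ∈ S, fun x : ι → ℝ => x i)
      (Measure.pi fun _ => volume.restrict (Set.Icc (0 : ℝ) 1)) (-l) ≤ l⁻¹ ^ S.card := by
  rw [(iIndepFun_pi_uniform ι).mgf_sum measurable_pi_apply, ← Finset.prod_const]
  refine Finset.prod_le_prod (fun i _ => ProbabilityTheory.mgf_nonneg) fun i _ => ?_
  have heval := measurePreserving_eval (fun _ : ι => volume.restrict (Set.Icc (0 : ℝ) 1)) i
  have hmap := mgf_uniform_neg_le hl
  rw [← heval.map_eq, ProbabilityTheory.mgf_map heval.measurable.aemeasurable (by fun_prop)] at hmap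
  exact hmap

theorem measureReal_sum_pi_uniform_le {ι : Type*} [Fintype ι] {S : Finset ι} (hS : S.Nonempty)
    {s : ℝ} (hs : 0 < s) :
    (Measure.pi fun _ => volume.restrict (Set.Icc (0 : ℝ) 1)).real
      {x : ι → ℝ | ∑ i ∈ S, x i ≤ s} ≤ (Real.exp 1 * s / S.card) ^ S.card := by
  set P := Measure.pi fun _ : ι => volume.restrict (Set.Icc (0 : ℝ) 1)
  have hcard : (0 : ℝ) < S.card := by exact_mod_cast hS.card_pos
  -- This value of `l` minimizes `exp (l * s) * l⁻¹ ^ S.card`.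
  let l : ℝ := S.card / s
  have hl : 0 < l := div_pos hcard hs
  have hint : Integrable (fun x => Real.exp (-l * (∑ i ∈ S, fun x : ι → ℝ => x i) x)) P := by
    refine (iIndepFun_pi_uniform ι).integrable_exp_mul_sum measurable_pi_apply fun i _ => ?_
    exact (measurePreserving_eval _ i).integrable_comp_of_integrable
      (g := fun t => Real.exp (-l * t)) (Continuous.integrableOn_Icc (by fun_prop))
  calc P.real {x : ι → ℝ | ∑ i ∈ S, x i ≤ s}
      = P.real {x | (∑ i ∈ S, fun x : ι → ℝ => x i) x ≤ s} := by simp only [Finset.sum_apply]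
    _ ≤ Real.exp (- -l * s) * ProbabilityTheory.mgf (∑ i ∈ S, fun x : ι → ℝ => x i) P (-l) :=
        ProbabilityTheory.measure_le_le_exp_mul_mgf s (neg_nonpos.2 hl.le) hint
    _ ≤ Real.exp (l * s) * l⁻¹ ^ S.card := by
        rw [neg_neg]
        gcongr
        exact mgf_sum_pi_uniform_neg_le S hl
    _ = (Real.exp 1 * s / S.card) ^ S.card := by
        rw [div_mul_cancel₀ _ hs.ne', inv_div, mul_div_assoc, mul_pow, ← Real.exp_nat_mul, mul_one]

variable {d n : ℕ}

theorem measureReal_cost_le {S : Finset (Edge d n)} (hS : S.Nonempty) {s : ℝ} (hs : 0 < s) :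
    (costLaw d n).real {W | cost W S ≤ s} ≤ (Real.exp 1 * s / S.card) ^ S.card :=
  measureReal_sum_pi_uniform_le hS hs

theorem le_card_mul_of_mem_spheres {S : Finset (Edge d n)} (hS : S ∈ spheres d n) :
    n ≤ S.card * (d + 1) := by
  have hcover : (Finset.univ : Finset (Fin n)) ⊆ S.biUnion Subtype.val := fun v _ => by
    simpa only [Finset.mem_biUnion] using hS.1 v
  simpa using (Finset.card_le_card hcover).trans
    (Finset.card_biUnion_le_card_mul S _ (d + 1) fun e _ => e.2.le)

/-- The number of spanning `d`-spheres on `n` vertices with `m` facets. -/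
def sphereCount (d n m : ℕ) : ℕ := {S | S ∈ spheres d n ∧ S.card = m}.ncard

theorem measureReal_minCost_lt_le_sum (hne : (spheres d n).Nonempty) (hn : 0 < n) {s : ℝ}
    (hs : 0 < s) :
    (costLaw d n).real {W | minCost W < s} ≤
      ∑ m ∈ Finset.Ico (n ⌈/⌉ (d + 1)) (Fintype.card (Edge d n) + 1),
        sphereCount d n m * (Real.exp 1 * s / m) ^ m := by
  classical
  let T : Finset (Finset (Edge d n)) := (spheres d n).toFinset
  have hcard : ∀ S ∈ T, S.card ∈ Finset.Ico (n ⌈/⌉ (d + 1)) (Fintype.card (Edge d n) + 1) :=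
    fun S hS => Finset.mem_Ico.2 ⟨(ceilDiv_le_iff_le_mul d.succ_pos).2 (by
      simpa only [mul_comm] using le_card_mul_of_mem_spheres (Set.mem_toFinset.1 hS)),
      Nat.lt_succ_of_le S.card_le_univ⟩
  have hnonempty : ∀ S ∈ T, S.Nonempty := fun S hS => by
    have hle := le_card_mul_of_mem_spheres (Set.mem_toFinset.1 hS)
    exact Finset.card_pos.1 (Nat.pos_of_mul_pos_right (hn.trans_le hle))
  have hsub : {W : Edge d n → ℝ | minCost W < s} ⊆ ⋃ S ∈ T, {W | cost W S ≤ s} := fun W hW => by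
    obtain ⟨S, hS, hmin⟩ := exists_minCost_eq hne W
    exact Set.mem_biUnion (Set.mem_toFinset.2 hS) (hmin.symm.trans_le hW.le)
  calc (costLaw d n).real {W | minCost W < s}
      ≤ ∑ S ∈ T, (costLaw d n).real {W | cost W S ≤ s} :=
        (measureReal_mono hsub (measure_ne_top _ _)).trans (measureReal_biUnion_finset_le _ _)
    _ ≤ ∑ S ∈ T, (Real.exp 1 * s / S.card) ^ S.card :=
        Finset.sum_le_sum fun S hS => measureReal_cost_le (hnonempty S hS) hs
    _ = ∑ m ∈ Finset.Ico (n ⌈/⌉ (d + 1)) (Fintype.card (Edge d n) + 1),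
          ∑ S ∈ T with S.card = m, (Real.exp 1 * s / m) ^ m := by
        rw [← Finset.sum_fiberwise_of_maps_to hcard]
        exact Finset.sum_congr rfl fun m _ => Finset.sum_congr rfl fun S hS => by
          rw [(Finset.mem_filter.1 hS).2]
    _ = _ := Finset.sum_congr rfl fun m _ => by
        rw [Finset.sum_const, nsmul_eq_mul, sphereCount, ← Set.ncard_coe_finset]
        simp [T]

theorem count_mul_tail_le {m : ℕ} {C β a k N n : ℝ} (hβ : β ≤ 1) (ha : 0 ≤ a) (hk : 0 ≤ k)
    (hn : 0 ≤ n) (hm : 0 < m) (hnm : n ≤ m * k)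
    (haC : (2 : ℝ) ^ C * Real.exp 1 * a * k ^ (1 - β) ≤ 1 / 2)
    (hN : N ≤ (2 : ℝ) ^ (C * m) * (m : ℝ) ^ (β * m)) :
    N * (Real.exp 1 * (a * n ^ (1 - β)) / m) ^ m ≤ (1 / 2) ^ m := by
  have hm₀ : (0 : ℝ) < m := by exact_mod_cast hm
  have hcount : (2 : ℝ) ^ (C * m) * (m : ℝ) ^ (β * m) = ((2 : ℝ) ^ C * (m : ℝ) ^ β) ^ m := by
    rw [mul_pow, ← Real.rpow_mul_natCast zero_le_two, ← Real.rpow_mul_natCast hm₀.le]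
  have hn_rpow : n ^ (1 - β) ≤ (m : ℝ) ^ (1 - β) * k ^ (1 - β) := by
    rw [← Real.mul_rpow hm₀.le hk]
    exact Real.rpow_le_rpow hn hnm (by linarith)
  have hm_rpow : (m : ℝ) ^ β * (m : ℝ) ^ (1 - β) = m := by simp [← Real.rpow_add hm₀]
  have hbase : (2 : ℝ) ^ C * (m : ℝ) ^ β * (Real.exp 1 * (a * n ^ (1 - β)) / m) ≤ 1 / 2 :=
    calc (2 : ℝ) ^ C * (m : ℝ) ^ β * (Real.exp 1 * (a * n ^ (1 - β)) / m)
        ≤ (2 : ℝ) ^ C * (m : ℝ) ^ β *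
            (Real.exp 1 * (a * ((m : ℝ) ^ (1 - β) * k ^ (1 - β))) / m) := by gcongr
      _ = (2 : ℝ) ^ C * Real.exp 1 * a * k ^ (1 - β) *
            ((m : ℝ) ^ β * (m : ℝ) ^ (1 - β)) / m := by ring
      _ = (2 : ℝ) ^ C * Real.exp 1 * a * k ^ (1 - β) := by
          rw [hm_rpow, mul_div_cancel_right₀ _ hm₀.ne']
      _ ≤ 1 / 2 := haC
  calc N * (Real.exp 1 * (a * n ^ (1 - β)) / m) ^ m
      ≤ ((2 : ℝ) ^ C * (m : ℝ) ^ β) ^ m * (Real.exp 1 * (a * n ^ (1 - β)) / m) ^ m := by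
        rw [← hcount]
        gcongr
    _ ≤ (1 / 2) ^ m := by
        rw [← mul_pow]
        exact pow_le_pow_left₀ (by positivity) hbase m

theorem measureReal_minCost_lt_le {C β a : ℝ} (hne : (spheres d n).Nonempty) (hn : 0 < n)
    (hβ : β ≤ 1) (ha : 0 < a)
    (haC : (2 : ℝ) ^ C * Real.exp 1 * a * (d + 1 : ℝ) ^ (1 - β) ≤ 1 / 2)
    (hC : ∀ m : ℕ, (sphereCount d n m : ℝ) ≤ (2 : ℝ) ^ (C * m) * (m : ℝ) ^ (β * m)) :
    (costLaw d n).real {W | minCost W < a * (n : ℝ) ^ (1 - β)} ≤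
      2 * (1 / 2) ^ (n ⌈/⌉ (d + 1)) := by
  calc (costLaw d n).real {W | minCost W < a * (n : ℝ) ^ (1 - β)}
      ≤ ∑ m ∈ Finset.Ico (n ⌈/⌉ (d + 1)) (Fintype.card (Edge d n) + 1),
          sphereCount d n m * (Real.exp 1 * (a * (n : ℝ) ^ (1 - β)) / m) ^ m :=
        measureReal_minCost_lt_le_sum hne hn (by positivity)
    _ ≤ ∑ m ∈ Finset.Ico (n ⌈/⌉ (d + 1)) (Fintype.card (Edge d n) + 1), (1 / 2 : ℝ) ^ m := by
        refine Finset.sum_le_sum fun m hm => ?_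
        have hnm : n ≤ (d + 1) * m :=
          (ceilDiv_le_iff_le_mul d.succ_pos).1 (Finset.mem_Ico.1 hm).1
        have hm₀ : 0 < m := Nat.pos_of_mul_pos_left (hn.trans_le hnm)
        refine count_mul_tail_le hβ ha.le (by positivity) n.cast_nonneg hm₀ ?_ haC (hC m)
        rw [mul_comm]
        exact_mod_cast hnm
    _ ≤ (1 / 2) ^ (n ⌈/⌉ (d + 1)) / (1 - 1 / 2) :=
        geom_sum_Ico_le_of_lt_one one_half_pos.le one_half_lt_one
    _ = 2 * (1 / 2) ^ (n ⌈/⌉ (d + 1)) := by ring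

theorem exists_tendsto_le_minCost (hd : 1 ≤ d) {β : ℝ} (hβ : IsCountExponent d β) (hβ₁ : β ≤ 1) :
    ∃ a : ℝ, 0 < a ∧ Tendsto
      (fun n : ℕ => costLaw d n {W | a * (n : ℝ) ^ (1 - β) ≤ minCost W}) atTop (𝓝 1) := by
  obtain ⟨C, hC⟩ := hβ
  let q : ℝ := (2 : ℝ) ^ C * Real.exp 1 * (d + 1 : ℝ) ^ (1 - β)
  have hq : 0 < q := by positivity
  have hceil : Tendsto (fun n : ℕ => n ⌈/⌉ (d + 1)) atTop atTop :=
    tendsto_atTop_mono (fun n => floorDiv_le_ceilDiv)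
      (Nat.tendsto_div_const_atTop d.succ_ne_zero)
  have hlim : Tendsto (fun n : ℕ => 2 * (1 / 2 : ℝ) ^ (n ⌈/⌉ (d + 1))) atTop (𝓝 0) := by
    simpa using ((tendsto_pow_atTop_nhds_zero_of_lt_one one_half_pos.le one_half_lt_one).comp
      hceil).const_mul (2 : ℝ)
  refine ⟨1 / 2 / q, by positivity, tendsto_measure_one_of_measureReal_compl_le hlim ?_⟩
  filter_upwards [eventually_ge_atTop (d + 2)] with n hn
  simp only [Set.compl_ofPred, not_le]
  refine measureReal_minCost_lt_le (C := C) (spheres_nonempty hd hn) (by omega) hβ₁ (by positivity)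
    (le_of_eq ?_) (hC n)
  calc (2 : ℝ) ^ C * Real.exp 1 * (1 / 2 / q) * (d + 1 : ℝ) ^ (1 - β) = 1 / 2 / q * q := by ring
    _ = 1 / 2 := div_mul_cancel₀ _ hq.ne'

end LowerBound

section DependsOn

variable {ι κ : Type*} [Fintype ι] {X : ι → Type*} [∀ i, MeasurableSpace (X i)]
  {μ : ∀ i, Measure (X i)} [∀ i, IsProbabilityMeasure (μ i)]

theorem measure_inter_of_dependsOn {s t : Finset ι} (hst : Disjoint s t) {A B : Set (∀ i, X i)}
    (hA : MeasurableSet A) (hB : MeasurableSet B) (hAs : DependsOn (· ∈ A) (s : Set ι))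
    (hBt : DependsOn (· ∈ B) (t : Set ι)) :
    Measure.pi μ (A ∩ B) = Measure.pi μ A * Measure.pi μ B := by
  classical
  obtain ⟨x₀⟩ := nonempty_of_isProbabilityMeasure (Measure.pi μ)
  have preimage_eq : ∀ {s : Finset ι} {A : Set (∀ i, X i)}, DependsOn (· ∈ A) (s : Set ι) →
      (fun x (i : s) => x i) ⁻¹' (Function.updateFinset x₀ s ⁻¹' A) = A := fun hAs => by
    ext x
    exact (hAs fun i hi => by simp_all [Function.updateFinset_def]).to_iff
  have indep : ProbabilityTheory.IndepFun (fun x (i : s) => x i) (fun x (i : t) => x i)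
      (Measure.pi μ) := (ProbabilityTheory.iIndepFun_pi (μ := μ) (X := fun _ => id)
    fun _ => aemeasurable_id).indepFun_finset s t hst fun i => measurable_pi_apply i
  have := indep.measure_inter_preimage_eq_mul _ _
    (hA.preimage (measurable_updateFinset (x := x₀)))
    (hB.preimage (measurable_updateFinset (x := x₀)))
  rwa [preimage_eq hAs, preimage_eq hBt] at this

theorem measure_biInter_of_dependsOn {R : Finset κ} {T : κ → Finset ι}
    (hT : (R : Set κ).PairwiseDisjoint T) {A : κ → Set (∀ i, X i)}
    (hA : ∀ v ∈ R, MeasurableSet (A v)) (hAT : ∀ v ∈ R, DependsOn (· ∈ A v) (T v : Set ι)) :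
    Measure.pi μ (⋂ v ∈ R, A v) = ∏ v ∈ R, Measure.pi μ (A v) := by
  classical
  induction R using Finset.induction_on with
  | empty => simp
  | insert v R hv ih =>
    rw [Finset.coe_insert, Set.pairwiseDisjoint_insert] at hT
    rw [Finset.forall_mem_insert] at hA hAT
    have disjoint_T : Disjoint (T v) (R.biUnion T) := (Finset.disjoint_biUnion_right _ _ _).2
      fun w hw => hT.2 w hw (ne_of_mem_of_not_mem hw hv).symm
    have dependsOn_biInter : DependsOn (· ∈ ⋂ w ∈ R, A w) (R.biUnion T : Set ι) :=
      fun x y hxy => by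
        simp only [Set.mem_iInter, eq_iff_iff]
        refine forall₂_congr fun w hw => (hAT.2 w hw fun i hi => hxy i ?_).to_iff
        exact Finset.mem_biUnion.2 ⟨w, hw, hi⟩
    rw [Finset.set_biInter_insert, Finset.prod_insert hv, ← ih hT.1 hA.2 hAT.2]
    exact measure_inter_of_dependsOn disjoint_T hA.1 (R.measurableSet_biInter hA.2) hAT.1
      dependsOn_biInter

variable [DecidableEq ι]

theorem lmarginal_eq_lintegral {s : Finset ι} {g : (∀ i, X i) → ENNReal} (hg : Measurable g)
    (hgs : DependsOn g s) (x : ∀ i, X i) : lmarginal μ s g x = ∫⁻ y, g y ∂Measure.pi μ := by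
  have lmarginal_const : ∀ y, lmarginal μ s g y = lmarginal μ s g x := fun y =>
    lintegral_congr fun z => hgs fun i hi => by simp_all [Function.updateFinset_def]
  rw [lintegral_eq_lmarginal_univ x, ← Finset.union_compl s,
    lmarginal_union' μ g hg disjoint_compl_right]
  change _ = ∫⁻ y, lmarginal μ s g _ ∂_
  simp_rw [lmarginal_const]
  simp

/-- The index minimising `p` is a function of the coordinates in `s`, hence independent of `g`. -/
theorem lintegral_iInf_add_le [Countable κ] {s : Finset ι} {R : Finset κ}
    (hR : R.Nonempty) {p g : κ → (∀ i, X i) → ENNReal} (hp : ∀ v, Measurable (p v))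
    (hg : ∀ v, Measurable (g v)) (hps : ∀ v ∈ R, DependsOn (p v) s)
    (hgs : ∀ v ∈ R, DependsOn (g v) (sᶜ : Finset ι)) {B : ENNReal}
    (hB : ∀ v ∈ R, ∫⁻ x, g v x ∂Measure.pi μ ≤ B) :
    ∫⁻ x, ⨅ v ∈ R, (p v x + g v x) ∂Measure.pi μ ≤
      (∫⁻ x, ⨅ v ∈ R, p v x ∂Measure.pi μ) + B := by
  have measurable_iInf : ∀ {f : κ → (∀ i, X i) → ENNReal}, (∀ v, Measurable (f v)) →
      Measurable fun x => ⨅ v ∈ R, f v x := fun hf => .iInf fun v => .iInf fun _ => hf v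
  suffices ∫⁻ x, ⨅ v ∈ R, (p v x + g v x) ∂Measure.pi μ ≤
      ∫⁻ x, (⨅ v ∈ R, p v x) + B ∂Measure.pi μ by
    simpa [lintegral_add_right _ measurable_const] using this
  refine lintegral_le_of_lmarginal_le sᶜ (measurable_iInf fun v => (hp v).add (hg v))
    ((measurable_iInf hp).add_const _) fun x => ?_
  obtain ⟨v, hv, hmin⟩ := Finset.exists_mem_eq_inf R hR fun v => p v x
  rw [Finset.inf_eq_iInf] at hmin
  have p_update : ∀ w ∈ R, ∀ z, p w (Function.updateFinset x sᶜ z) = p w x := fun w hw z =>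
    hps w hw fun i hi => by simp_all [Function.updateFinset_def]
  have iInf_update : ∀ z, ⨅ w ∈ R, p w (Function.updateFinset x sᶜ z) = p v x := fun z =>
    (iInf_congr fun w => iInf_congr fun hw => p_update w hw z).trans hmin
  calc lmarginal μ sᶜ (fun x => ⨅ v ∈ R, (p v x + g v x)) x
      ≤ ∫⁻ z, (p v x + g v (Function.updateFinset x sᶜ z)) ∂Measure.pi fun i : ↥sᶜ => μ i :=
        lintegral_mono fun z => (iInf₂_le v hv).trans_eq (by rw [p_update v hv z])
    _ = p v x + lmarginal μ sᶜ (g v) x := by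
        rw [lintegral_add_left measurable_const, lintegral_const, measure_univ, mul_one]
        rfl
    _ ≤ p v x + B := by
        rw [lmarginal_eq_lintegral (hg v) (hgs v hv)]
        gcongr
        exact hB v hv
    _ = lmarginal μ sᶜ (fun x => (⨅ v ∈ R, p v x) + B) x := by simp [lmarginal, iInf_update]

end DependsOn

section Insertion

theorem lintegral_le_of_measure_lt_le_exp {Ω : Type*} [MeasurableSpace Ω] {P : Measure Ω}
    {f : Ω → ENNReal} (hf : Measurable f) (hf_top : ∀ ω, f ω ≠ ⊤) {b p : ℝ} (hb : 0 < b)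
    (hp : 0 < p)
    (htail : ∀ t > 0, P {ω | ENNReal.ofReal t < f ω} ≤ ENNReal.ofReal (Real.exp (-b * t ^ p))) :
    ∫⁻ ω, f ω ∂P ≤ ENNReal.ofReal (b ^ (-1 / p) * Real.Gamma (1 / p + 1)) := by
  have integrable_exp : IntegrableOn (fun t : ℝ => Real.exp (-b * t ^ p)) (Set.Ioi 0) := by
    simpa using integrableOn_rpow_mul_exp_neg_mul_rpow (s := 0) (by norm_num) hp hb
  calc ∫⁻ ω, f ω ∂P = ∫⁻ ω, ENNReal.ofReal (f ω).toReal ∂P := by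
        simp only [ENNReal.ofReal_toReal (hf_top _)]
    _ = ∫⁻ t in Set.Ioi 0, P {ω | t < (f ω).toReal} :=
        lintegral_eq_lintegral_meas_lt P (ae_of_all _ fun ω => ENNReal.toReal_nonneg)
          hf.ennreal_toReal.aemeasurable
    _ ≤ ∫⁻ t in Set.Ioi 0, ENNReal.ofReal (Real.exp (-b * t ^ p)) := by
        refine setLIntegral_mono' measurableSet_Ioi fun t ht => (measure_mono ?_).trans (htail t ht)
        exact fun ω hω => (ENNReal.ofReal_lt_iff_lt_toReal (le_of_lt ht) (hf_top ω)).2 hω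
    _ = ENNReal.ofReal (b ^ (-1 / p) * Real.Gamma (1 / p + 1)) := by
        rw [← ofReal_integral_eq_lintegral_ofReal integrable_exp
          (ae_of_all _ fun t => (Real.exp_pos _).le), integral_exp_neg_mul_rpow hp hb]

theorem measure_pi_uniform_exists_lt_le {ι : Type*} [Fintype ι] (T : Finset ι) {s : ℝ}
    (hs : 0 ≤ s) :
    Measure.pi (fun _ : ι => volume.restrict (Set.Icc (0 : ℝ) 1)) {x | ∃ i ∈ T, s < x i} ≤
      ENNReal.ofReal (Real.exp (-s ^ T.card)) := by
  have uniform_Iic : volume.restrict (Set.Icc (0 : ℝ) 1) (Set.Iic s) =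
      ENNReal.ofReal (min 1 s) := by
    rw [Measure.restrict_apply measurableSet_Iic, Set.inter_comm, ← Set.Ici_inter_Iic,
      Set.inter_assoc, Set.Iic_inter_Iic, Set.Ici_inter_Iic, Real.volume_Icc, sub_zero]
  have set_eq : {x : ι → ℝ | ∃ i ∈ T, s < x i} = ((T : Set ι).pi fun _ => Set.Iic s)ᶜ := by
    ext x
    simp [Set.mem_pi]
  have hmin : 0 ≤ min 1 s := le_min zero_le_one hs
  have one_sub_le : 1 - min 1 s ^ T.card ≤ Real.exp (-s ^ T.card) := by
    rcases le_total s 1 with h | h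
    · simpa [h] using Real.one_sub_le_exp_neg (s ^ T.card)
    · simpa [h] using (Real.exp_pos _).le
  rw [set_eq, prob_compl_eq_one_sub (.pi T.countable_toSet fun _ _ => measurableSet_Iic),
    Measure.pi_pi_finset, Finset.prod_const, uniform_Iic, ← ENNReal.ofReal_pow hmin,
    ← ENNReal.ofReal_one, ← ENNReal.ofReal_sub _ (pow_nonneg hmin _)]
  exact ENNReal.ofReal_le_ofReal one_sub_le

variable {d n : ℕ} {F : Edge d n} {R : Finset (Fin n)} {v : Fin n}

/-- The facets paid for in `stepCost W F v`. -/
def boughtFacets (F : Edge d n) (v : Fin n) : Finset (Edge d n) :=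
  (F.1.erase (pivot F)).image fun u => swap F u v

theorem card_boughtFacets (hv : v ∉ F.1) : (boughtFacets F v).card = d := by
  rw [boughtFacets, Finset.card_image_of_injOn ((swap_injOn hv).mono (by simp)),
    Finset.card_erase_of_mem (pivot_mem F), F.2]
  rfl

theorem mem_of_mem_boughtFacets (hv : v ∉ F.1) {e : Edge d n} (he : e ∈ boughtFacets F v) :
    v ∈ e.1 ∧ pivot F ∈ e.1 ∧ e.1 ⊆ insert v F.1 := by
  obtain ⟨u, hu, rfl⟩ := Finset.mem_image.1 he
  obtain ⟨hup, hu⟩ := Finset.mem_erase.1 hu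
  rw [swap_val hu hv]
  exact ⟨by simp, by simp [pivot_mem F, hup.symm],
    Finset.insert_subset_insert _ (Finset.erase_subset _ _)⟩

theorem pairwiseDisjoint_boughtFacets (hR : Disjoint F.1 R) :
    (R : Set (Fin n)).PairwiseDisjoint (boughtFacets F) := by
  refine fun v hv w hw hvw => Finset.disjoint_left.2 fun e hev hew => ?_
  have v_mem := (mem_of_mem_boughtFacets (Finset.disjoint_right.1 hR hv) hev).1
  have subset := (mem_of_mem_boughtFacets (Finset.disjoint_right.1 hR hw) hew).2.2
  exact (Finset.mem_insert.1 (subset v_mem)).elim hvw (Finset.disjoint_right.1 hR hv)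

theorem dependsOn_stepCost (F : Edge d n) (v : Fin n) :
    DependsOn (fun W => stepCost W F v) (boughtFacets F v : Set (Edge d n)) :=
  fun _ _ h => Finset.sum_congr rfl fun _ hu => h _ (Finset.mem_image_of_mem _ hu)

theorem dependsOn_insertionCost (r : ℕ) (hR : Disjoint F.1 R) :
    DependsOn (insertionCost r F R) {e | e.1 ⊆ F.1 ∪ R} := by
  induction r generalizing F R with
  | zero => exact fun _ _ _ => rfl
  | succ r ih =>
    refine fun W W' h => iInf_congr fun v => iInf_congr fun hv => ?_
    have hvF : v ∉ F.1 := Finset.disjoint_right.1 hR hv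
    have stepCost_eq : stepCost W F v = stepCost W' F v := dependsOn_stepCost F v fun e he =>
      h e <| (mem_of_mem_boughtFacets hvF he).2.2.trans <|
        Finset.insert_subset (Finset.mem_union_right _ hv) Finset.subset_union_left
    rw [stepCost_eq, ih (disjoint_nextFacet hv hR) fun e he => h e <|
      he.trans <| (nextFacet_union_subset hv hR).trans (Finset.erase_subset _ _)]

theorem costLaw_forall_lt_stepCost_le (hd : 1 ≤ d) (hR : Disjoint F.1 R) {t : ℝ} (ht : 0 ≤ t) :
    costLaw d n {W | ∀ v ∈ R, t < stepCost W F v} ≤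
      ENNReal.ofReal (Real.exp (-(R.card / d ^ d) * t ^ d)) := by
  let expensive : Fin n → Set (Edge d n → ℝ) := fun v => {W | ∃ e ∈ boughtFacets F v, t / d < W e}
  have subset_expensive : {W | ∀ v ∈ R, t < stepCost W F v} ⊆ ⋂ v ∈ R, expensive v := by
    refine fun W hW => Set.mem_iInter₂.2 fun v hv => ?_
    by_contra hcheap
    simp only [expensive, Set.mem_ofPred_eq, not_exists, not_and, not_lt] at hcheap
    have := stepCost_le fun u hu => hcheap _ (Finset.mem_image_of_mem _ hu)
    rw [mul_div_cancel₀ _ (by positivity)] at this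
    exact this.not_gt (hW v hv)
  have measurable_expensive : ∀ v ∈ R, MeasurableSet (expensive v) := fun v _ => by
    measurability
  have dependsOn_expensive :
      ∀ v ∈ R, DependsOn (· ∈ expensive v) (boughtFacets F v : Set (Edge d n)) :=
    fun v _ W W' h => propext <| exists_congr fun e => and_congr_right fun he => by rw [h e he]
  calc costLaw d n {W | ∀ v ∈ R, t < stepCost W F v}
      ≤ ∏ v ∈ R, costLaw d n (expensive v) := by
        exact (measure_mono subset_expensive).trans_eq (measure_biInter_of_dependsOn
          (pairwiseDisjoint_boughtFacets hR) measurable_expensive dependsOn_expensive)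
    _ ≤ ∏ _ ∈ R, ENNReal.ofReal (Real.exp (-(t / d) ^ d)) := by
        refine Finset.prod_le_prod' fun v hv => ?_
        refine (measure_pi_uniform_exists_lt_le (boughtFacets F v) (by positivity)).trans_eq ?_
        rw [card_boughtFacets (Finset.disjoint_right.1 hR hv)]
    _ = ENNReal.ofReal (Real.exp (-(R.card / d ^ d) * t ^ d)) := by
        rw [Finset.prod_const, ← ENNReal.ofReal_pow (Real.exp_pos _).le, ← Real.exp_nat_mul]
        congr 2
        ring

theorem lintegral_iInf_stepCost_le (hd : 1 ≤ d) (hR : Disjoint F.1 R) (hne : R.Nonempty) :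
    ∫⁻ W, ⨅ v ∈ R, ENNReal.ofReal (stepCost W F v) ∂costLaw d n ≤
      ENNReal.ofReal (d * Real.Gamma (1 / d + 1) * (R.card : ℝ) ^ (-(1 / d : ℝ))) := by
  have hd₀ : (0 : ℝ) < d := by positivity
  have hcard : (0 : ℝ) < R.card := by exact_mod_cast hne.card_pos
  refine (lintegral_le_of_measure_lt_le_exp (b := R.card / d ^ d) (p := d)
    (.iInf fun v => .iInf fun _ => (measurable_stepCost F v).ennreal_ofReal) (fun W => ?_)
    (by positivity) hd₀ fun t ht => ?_).trans_eq ?_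
  · obtain ⟨v, hv⟩ := hne
    exact ne_top_of_le_ne_top ENNReal.ofReal_ne_top (iInf₂_le v hv)
  · rw [Real.rpow_natCast]
    refine (measure_mono fun W hW v hv => ?_).trans (costLaw_forall_lt_stepCost_le hd hR ht.le)
    exact (ENNReal.ofReal_lt_ofReal_iff_of_nonneg ht.le).1 (hW.trans_le (iInf₂_le v hv))
  · rw [neg_div, Real.div_rpow hcard.le (by positivity),
      Real.rpow_neg (by positivity : 0 ≤ (d : ℝ) ^ d), ← Real.rpow_natCast, ← Real.rpow_mul hd₀.le,
      mul_one_div_cancel hd₀.ne', Real.rpow_one, div_inv_eq_mul]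
    ring_nf

theorem lintegral_insertionCost_le (hd : 1 ≤ d) (hR : Disjoint F.1 R) {r : ℕ} (hr : R.card = r) :
    ∫⁻ W, insertionCost r F R W ∂costLaw d n ≤ ∑ k ∈ Finset.range r,
      ENNReal.ofReal (d * Real.Gamma (1 / d + 1) * ((k + 1 : ℕ) : ℝ) ^ (-(1 / d : ℝ))) := by
  induction r generalizing F R with
  | zero => simp [insertionCost]
  | succ r ih =>
    have hne : R.Nonempty := Finset.card_pos.1 (by lia)
    have step_dependsOn : ∀ v ∈ R, DependsOn (fun W => ENNReal.ofReal (stepCost W F v))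
        (Finset.univ.filter fun e : Edge d n => pivot F ∈ e.1) := fun v hv W W' h =>
      congrArg _ <| dependsOn_stepCost F v fun e he => h e <| by
        simpa using (mem_of_mem_boughtFacets (Finset.disjoint_right.1 hR hv) he).2.1
    have rest_dependsOn : ∀ v ∈ R, DependsOn (insertionCost r (nextFacet F v) (R.erase v))
        ((Finset.univ.filter fun e : Edge d n => pivot F ∈ e.1)ᶜ : Finset (Edge d n)) :=
      fun v hv W W' h => dependsOn_insertionCost r (disjoint_nextFacet hv hR) fun e he =>
        h e <| by
          have := fun hp => Finset.notMem_erase _ _ (nextFacet_union_subset hv hR (he hp))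
          simpa using this
    rw [Finset.sum_range_succ, add_comm (Finset.sum _ _)]
    refine (lintegral_iInf_add_le hne (fun v => (measurable_stepCost F v).ennreal_ofReal)
      (fun v => measurable_insertionCost _ _ _) step_dependsOn rest_dependsOn fun v hv =>
        ih (disjoint_nextFacet hv hR) (by rw [Finset.card_erase_of_mem hv, hr]; rfl)).trans ?_
    gcongr
    rw [← hr]
    exact lintegral_iInf_stepCost_le hd hR hne

end Insertion

section UpperBound

theorem half_le_measureReal_le_two_mul {Ω : Type*} [MeasurableSpace Ω] {P : Measure Ω}
    [IsProbabilityMeasure P] {X : Ω → ℝ} (hX : Measurable X) {m : ℝ} (hm : 0 < m)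
    (hXm : ∫⁻ ω, ENNReal.ofReal (X ω) ∂P ≤ ENNReal.ofReal m) :
    1 / 2 ≤ P.real {ω | X ω ≤ 2 * m} := by
  have markov : P {ω | X ω ≤ 2 * m}ᶜ ≤ ENNReal.ofReal (1 / 2) :=
    calc P {ω | X ω ≤ 2 * m}ᶜ
        ≤ P {ω | ENNReal.ofReal (2 * m) ≤ ENNReal.ofReal (X ω)} :=
          measure_mono fun ω hω => ENNReal.ofReal_le_ofReal (le_of_lt (not_le.1 hω))
      _ ≤ (∫⁻ ω, ENNReal.ofReal (X ω) ∂P) / ENNReal.ofReal (2 * m) :=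
          meas_ge_le_lintegral_div hX.ennreal_ofReal.aemeasurable (by simpa using hm)
            ENNReal.ofReal_ne_top
      _ ≤ ENNReal.ofReal m / ENNReal.ofReal (2 * m) := by gcongr
      _ = ENNReal.ofReal (1 / 2) := by
          rw [← ENNReal.ofReal_div_of_pos (by positivity)]
          congr 1
          field_simp
  have := ENNReal.toReal_le_of_le_ofReal (by norm_num) markov
  rw [← measureReal_def, probReal_compl_eq_one_sub (measurableSet_le hX measurable_const)] at this
  linarith

theorem SqrtIsoperimetry.measureReal_ge_le_of_lintegral_le {Ω : Type*} [MeasurableSpace Ω]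
    {P : Measure Ω} [IsProbabilityMeasure P] {X : Ω → ℝ} (hiso : SqrtIsoperimetry P X)
    (hX : Measurable X) {m : ℝ} (hm : 0 < m)
    (hXm : ∫⁻ ω, ENNReal.ofReal (X ω) ∂P ≤ ENNReal.ofReal m) :
    P.real {ω | 8 * m ≤ X ω} ≤ 1 / 2 * Real.exp (-(m / 4)) := by
  have sqrt_sub : √(8 * m) - √(2 * m) = √(2 * m) := by
    rw [show 8 * m = 2 ^ 2 * (2 * m) by ring, Real.sqrt_mul (by positivity),
      Real.sqrt_sq (by norm_num)]
    ring
  have := hiso.measureReal_ge_le (by positivity) (by linarith : 2 * m < 8 * m)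
    (half_le_measureReal_le_two_mul hX hm hXm)
  rwa [sqrt_sub, Real.sq_sqrt (by positivity), show 2 * m / 8 = m / 4 by ring] at this

theorem sum_rpow_sub_one_le {p : ℝ} (hp₀ : 0 < p) (hp₁ : p ≤ 1) (r : ℕ) :
    ∑ k ∈ Finset.range r, ((k + 1 : ℕ) : ℝ) ^ (p - 1) ≤ (r : ℝ) ^ p / p := by
  rw [le_div_iff₀ hp₀]
  induction r with
  | zero => simp [hp₀.ne']
  | succ r ih =>
    have hr : (0 : ℝ) < (r + 1 : ℕ) := by positivity
    have bernoulli : (r : ℝ) ^ p ≤ ((r + 1 : ℕ) : ℝ) ^ p * (1 - p / (r + 1 : ℕ)) := by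
      have hle : (-1 : ℝ) ≤ -1 / (r + 1 : ℕ) := by
        rw [le_div_iff₀ hr]
        push_cast
        linarith [r.cast_nonneg (α := ℝ)]
      calc (r : ℝ) ^ p = ((r + 1 : ℕ) : ℝ) ^ p * (1 + -1 / (r + 1 : ℕ)) ^ p := by
            rw [← Real.mul_rpow hr.le (by linarith)]
            congr 1
            field_simp
            push_cast
            ring
        _ ≤ _ := by
            gcongr
            exact (rpow_one_add_le_one_add_mul_self hle hp₀.le hp₁).trans_eq (by ring)
    rw [Finset.sum_range_succ, add_mul, Real.rpow_sub_one hr.ne']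
    linarith [ih, bernoulli, (by ring : ((r + 1 : ℕ) : ℝ) ^ p * (1 - p / (r + 1 : ℕ)) =
      ((r + 1 : ℕ) : ℝ) ^ p - ((r + 1 : ℕ) : ℝ) ^ p / (r + 1 : ℕ) * p)]

theorem lintegral_minCost_le {d n : ℕ} (hd : 1 ≤ d) (hn : d + 2 ≤ n) :
    ∫⁻ W, ENNReal.ofReal (minCost W) ∂costLaw d n ≤
      ENNReal.ofReal (d + 2 + d * Real.Gamma (1 / d + 1) *
        ∑ k ∈ Finset.range (n - (d + 2)), ((k + 1 : ℕ) : ℝ) ^ (-(1 / d : ℝ))) := by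
  obtain ⟨F, R, hR, hcard, hle⟩ := exists_minCost_le_insertionCost hd hn
  calc ∫⁻ W, ENNReal.ofReal (minCost W) ∂costLaw d n
      ≤ ∫⁻ W, ((d + 2 : ℕ) + insertionCost (n - (d + 2)) F R W) ∂costLaw d n :=
        lintegral_mono_ae <| (ae_costLaw_mem_Icc d n).mono fun W hW => hle W fun e => (hW e).2
    _ = (d + 2 : ℕ) + ∫⁻ W, insertionCost (n - (d + 2)) F R W ∂costLaw d n := by
        rw [lintegral_add_left measurable_const, lintegral_const, measure_univ, mul_one]
    _ ≤ (d + 2 : ℕ) + ∑ k ∈ Finset.range (n - (d + 2)),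
          ENNReal.ofReal (d * Real.Gamma (1 / d + 1) * ((k + 1 : ℕ) : ℝ) ^ (-(1 / d : ℝ))) := by
        gcongr
        exact lintegral_insertionCost_le hd hR hcard
    _ = _ := by
        rw [← ENNReal.ofReal_sum_of_nonneg fun k _ => by positivity, ← ENNReal.ofReal_natCast,
          ← ENNReal.ofReal_add (by positivity) (Finset.sum_nonneg fun k _ => by positivity),
          Finset.mul_sum]
        push_cast
        rfl

theorem exists_lintegral_minCost_le {d : ℕ} (hd : 2 ≤ d) :
    ∃ A > 0, ∀ n, d + 2 ≤ n → ∫⁻ W, ENNReal.ofReal (minCost W) ∂costLaw d n ≤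
      ENNReal.ofReal (A * (n : ℝ) ^ (1 - 1 / d : ℝ)) := by
  have hp₀ : (0 : ℝ) < 1 - 1 / d := by
    rw [sub_pos, div_lt_one (by positivity)]
    exact_mod_cast hd
  have hp₁ : (1 - 1 / d : ℝ) ≤ 1 := sub_le_self _ (by positivity)
  refine ⟨d + 2 + d * Real.Gamma (1 / d + 1) / (1 - 1 / d), by positivity, fun n hn => ?_⟩
  have one_le : 1 ≤ (n : ℝ) ^ (1 - 1 / d : ℝ) :=
    Real.one_le_rpow (by exact_mod_cast (by lia : 1 ≤ n)) hp₀.le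
  have sum_le : ∑ k ∈ Finset.range (n - (d + 2)), ((k + 1 : ℕ) : ℝ) ^ (-(1 / d : ℝ)) ≤
      (n : ℝ) ^ (1 - 1 / d : ℝ) / (1 - 1 / d) := by
    have := sum_rpow_sub_one_le hp₀ hp₁ (n - (d + 2))
    rw [sub_sub_cancel_left] at this
    refine this.trans ?_
    gcongr
    exact n.sub_le _
  refine (lintegral_minCost_le (by lia) hn).trans (ENNReal.ofReal_le_ofReal ?_)
  rw [add_mul _ _ ((n : ℝ) ^ _), div_mul_eq_mul_div, mul_div_assoc]
  gcongr
  exact le_mul_of_one_le_right (by positivity) one_le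

theorem exists_tendsto_minCost_le {d : ℕ} (hd : 2 ≤ d) :
    ∃ b : ℝ, Tendsto (fun n : ℕ => costLaw d n {W | minCost W ≤ b * (n : ℝ) ^ (1 - 1 / (d : ℝ))})
      atTop (𝓝 1) := by
  have hp₀ : (0 : ℝ) < 1 - 1 / d := by
    rw [sub_pos, div_lt_one (by positivity)]
    exact_mod_cast hd
  obtain ⟨A, hA₀, hA⟩ := exists_lintegral_minCost_le hd
  refine ⟨8 * A, tendsto_measure_one_of_measureReal_compl_le
    (u := fun n => 1 / 2 * Real.exp (-(A * (n : ℝ) ^ (1 - 1 / d : ℝ) / 4))) ?_ ?_⟩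
  · have tendsto_pow := (tendsto_rpow_atTop hp₀).comp tendsto_natCast_atTop_atTop
    have tendsto_exponent := (tendsto_pow.const_mul_atTop hA₀).atTop_div_const (zero_lt_four' ℝ)
    simpa using (Real.tendsto_exp_neg_atTop_nhds_zero.comp tendsto_exponent).const_mul 2⁻¹
  · filter_upwards [eventually_ge_atTop (d + 2)] with n hn
    have hn₀ : (0 : ℝ) < n := by exact_mod_cast (by lia : 0 < n)
    refine le_trans (measureReal_mono fun W hW => ?_)
      ((sqrtIsoperimetry_minCost (spheres_nonempty (by lia) hn)).measureReal_ge_le_of_lintegral_le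
        measurable_minCost (by positivity) (hA n hn))
    rw [Set.compl_ofPred, Set.mem_ofPred_eq, not_le, mul_assoc] at hW
    exact hW.le

end UpperBound

end SpanningSphere

end

theorem theorem1p2_general (d : ℕ) (hd : 1 ≤ d) :
    (∀ n : ℕ, d + 2 ≤ n → (SpanningSphere.spheres d n).Nonempty) ∧
    (2 ≤ d → ∃ b : ℝ, Tendsto
      (fun n : ℕ => SpanningSphere.costLaw d n
        {W | SpanningSphere.minCost W ≤ b * (n : ℝ) ^ (1 - 1 / (d : ℝ))})
      atTop (𝓝 1)) ∧
    (∀ β : ℝ, SpanningSphere.IsCountExponent d β → β ≤ 1 →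
      ∃ a : ℝ, 0 < a ∧ Tendsto
        (fun n : ℕ => SpanningSphere.costLaw d n
          {W | a * (n : ℝ) ^ (1 - β) ≤ SpanningSphere.minCost W})
        atTop (𝓝 1)) ∧
    (∃ c : ℝ, 0 < c ∧ ∀ n : ℕ, d + 2 ≤ n → ∀ μ : ℝ,
      SpanningSphere.IsMedian (SpanningSphere.costLaw d n) SpanningSphere.minCost μ →
      ∀ t : ℝ, 0 < t →
        (SpanningSphere.costLaw d n).real {W | t < |SpanningSphere.minCost W - μ|}
          ≤ Real.exp (-(c * t ^ 2 / n))) :=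
  ⟨fun _ hn => SpanningSphere.spheres_nonempty hd hn,
    SpanningSphere.exists_tendsto_minCost_le,
    fun _ hβ hβ₁ => SpanningSphere.exists_tendsto_le_minCost hd hβ hβ₁,
    1 / (32 * d), by positivity, fun _ hn _ hμ _ ht =>
      SpanningSphere.minCost_concentration hd hn hμ ht⟩

theorem theorem1p2 (d : ℕ) (hd : 2 ≤ d) :
    (∀ n : ℕ, d + 2 ≤ n → (SpanningSphere.spheres d n).Nonempty) ∧
    (∃ b : ℝ, Tendsto
      (fun n : ℕ => SpanningSphere.costLaw d n
        {W | SpanningSphere.minCost W ≤ b * (n : ℝ) ^ (1 - 1 / (d : ℝ))})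
      atTop (𝓝 1)) ∧
    (∀ β : ℝ, SpanningSphere.IsCountExponent d β → β ≤ 1 →
      ∃ a : ℝ, 0 < a ∧ Tendsto
        (fun n : ℕ => SpanningSphere.costLaw d n
          {W | a * (n : ℝ) ^ (1 - β) ≤ SpanningSphere.minCost W})
        atTop (𝓝 1)) ∧
    (∀ β : ℝ, SpanningSphere.IsCountExponent d β → β < 1 / 2 →
      ∃ c : ℝ, 0 < c ∧ ∀ n : ℕ, d + 2 ≤ n → ∀ μ : ℝ,
        SpanningSphere.IsMedian (SpanningSphere.costLaw d n) SpanningSphere.minCost μ →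
        ∀ t : ℝ, 0 < t →
          (SpanningSphere.costLaw d n).real {W | t < |SpanningSphere.minCost W - μ|}
            ≤ Real.exp (-(c * t ^ 2 / n))) :=
  let ⟨nonempty, upper, lower, concentration⟩ := theorem1p2_general d (by lia)
  ⟨nonempty, upper hd, lower, fun _ _ _ => concentration⟩
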